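/- Let $\sigma>0$ and define positive weights $\beta_m$ by $\beta_0=1$ and $\beta_{m+1}^2=\beta_m^2\,\frac{m+1}{m+\sigma}$ for $m\ge 0$. Let $\mathcal H_\beta$ be the Hilbert space of power series $f=\sum_{n\ge 0}a_nz^n$ with $\|f\|_\beta^2=\sum_{n\ge0}|a_n|^2\beta_n^2<\infty$; its elements are analytic functions on the open unit disk $\mathbb D$. For $k\ge 0$ let $\mathcal H_\beta^k$ be the set of $f\in\mathcal H_\beta$ whose $k$-th derivative is also in $\mathcal H_\beta$. Let $N\ge 1$ and let $L=\sum_{k=0}^N p_k(z)D^k$, $D=d/dz$, be $\mathbb D$-regular of order $N$: the coefficients $p_0,\dots,p_N$ are analytic on a neighborhood of $\overline{\mathbb D}$, and $p_N(z)\neq 0$ whenever $|z|=1$. Assume that $\sigma\ge 1$ or that $p_N$ is a polynomial. Let $K$ be the number of roots of $p_N$ in $\mathbb D$, counted with multiplicity. **Theorem.** $L$ maps $\mathcal H_\beta^N$ into $\mathcal H_\beta$, and the operator $\mathcal L$ on $\mathcal H_\beta$ with domain $\mathcal H_\beta^N$, acting by $\mathcal Lf=Lf$, is Fredholm with index $N-K$.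 That is, $\mathcal L$ is a closed operator, its null space is finite dimensional, its range is closed and of finite codimension, and $$\dim(\operatorname{null}\mathcal L)-\operatorname{codim}(\operatorname{range}\mathcal L)=N-K .$$ -/

import Mathlib

open scoped ENNReal PowerSeries

noncomputable section

/-! ### Weighted Hardy spaces -/

/-- The weighted Hardy space `H_β`: the formal power series `∑ aₙ zⁿ` over `ℂ` with
`∑ |aₙ|² βₙ² < ∞`. -/
def weightedHardy (β : ℕ → ℝ) : Submodule ℂ ℂ⟦X⟧ where
  carrier := {f | Memℓp (fun n => (β n : ℂ) * PowerSeries.coeff n f) 2}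
  zero_mem' := by
    have h : (fun n => (β n : ℂ) * PowerSeries.coeff n (0 : ℂ⟦X⟧)) = (0 : ℕ → ℂ) := by
      funext n; simp
    simpa only [Set.mem_ofPred_eq, h] using zero_memℓp
  add_mem' := by
    intro f g hf hg
    have h : (fun n => (β n : ℂ) * PowerSeries.coeff n (f + g)) =
        (fun n => (β n : ℂ) * PowerSeries.coeff n f) +
          (fun n => (β n : ℂ) * PowerSeries.coeff n g) := by
      funext n; simp [mul_add]
    simpa only [Set.mem_ofPred_eq, h] using Memℓp.add hf hg
  smul_mem' := by
    intro c f hf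
    have h : (fun n => (β n : ℂ) * PowerSeries.coeff n (c • f)) =
        c • (fun n => (β n : ℂ) * PowerSeries.coeff n f) := by
      funext n; simp [mul_left_comm]
    simpa only [Set.mem_ofPred_eq, h] using Memℓp.const_smul hf c

/-- The coordinates `(βₙ aₙ)` of `∑ aₙ zⁿ ∈ H_β` in the basis `zⁿ / βₙ`, as an element of `ℓ²`. -/
def weightedHardy.toLp (β : ℕ → ℝ) : weightedHardy β →ₗ[ℂ] lp (fun _ : ℕ => ℂ) 2 where
  toFun f := ⟨fun n => (β n : ℂ) * PowerSeries.coeff n (f : ℂ⟦X⟧), f.2⟩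
  map_add' f g := by
    ext n
    change (β n : ℂ) * PowerSeries.coeff n ((f : ℂ⟦X⟧) + (g : ℂ⟦X⟧)) = _ + _
    rw [map_add, mul_add]
  map_smul' c f := by ext n; simp [mul_left_comm]

theorem weightedHardy.toLp_injective (β : ℕ → ℝ) [hβ : Fact (∀ n, 0 < β n)] :
    Function.Injective (weightedHardy.toLp β) := by
  intro f g h
  ext n
  have h1 : (β n : ℂ) * PowerSeries.coeff n (f : ℂ⟦X⟧) =
      (β n : ℂ) * PowerSeries.coeff n (g : ℂ⟦X⟧) :=
    congrArg (fun u : lp (fun _ : ℕ => ℂ) 2 => u n) h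
  exact mul_left_cancel₀ (Complex.ofReal_ne_zero.mpr (hβ.out n).ne') h1

/-- The norm of `H_β`, `‖∑ aₙ zⁿ‖² = ∑ |aₙ|² βₙ²`. -/
instance weightedHardy.instNormedAddCommGroup (β : ℕ → ℝ) [Fact (∀ n, 0 < β n)] :
    NormedAddCommGroup (weightedHardy β) :=
  NormedAddCommGroup.induced _ _ (weightedHardy.toLp β) (weightedHardy.toLp_injective β)

/-- The inner product of `H_β`; Mathlib's inner products are conjugate linear in the first
argument. -/
instance weightedHardy.instInnerProductSpace (β : ℕ → ℝ) [Fact (∀ n, 0 < β n)] :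
    InnerProductSpace ℂ (weightedHardy β) where
  norm_smul_le c f := by
    change ‖weightedHardy.toLp β (c • f)‖ ≤ ‖c‖ * ‖weightedHardy.toLp β f‖
    rw [map_smul]
    exact norm_smul_le _ _
  inner f g := inner ℂ (weightedHardy.toLp β f) (weightedHardy.toLp β g)
  norm_sq_eq_re_inner f := norm_sq_eq_re_inner (𝕜 := ℂ) (weightedHardy.toLp β f)
  conj_inner_symm f g := inner_conj_symm (𝕜 := ℂ) _ _
  add_left f g h := by simp only [map_add, inner_add_left]
  smul_left f g c := by simp only [map_smul, inner_smul_left]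

theorem weightedHardy.norm_sq_eq (β : ℕ → ℝ) [Fact (∀ n, 0 < β n)] (f : weightedHardy β) :
    ‖f‖ ^ 2 = ∑' n, ‖PowerSeries.coeff n (f : ℂ⟦X⟧)‖ ^ 2 * β n ^ 2 := by
  have h := lp.norm_rpow_eq_tsum (p := 2) (by norm_num) (weightedHardy.toLp β f)
  have h2 : ‖f‖ = ‖weightedHardy.toLp β f‖ := rfl
  simp only [ENNReal.toReal_ofNat, Real.rpow_ofNat] at h
  rw [h2, h]
  refine tsum_congr fun n => ?_
  change ‖(β n : ℂ) * PowerSeries.coeff n (f : ℂ⟦X⟧)‖ ^ 2 = _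
  rw [norm_mul, Complex.norm_real, mul_pow, Real.norm_eq_abs, sq_abs, mul_comm]

/-- The function `z ↦ ∑ aₙ zⁿ` defined by a power series; it is used inside the disk of
convergence. -/
def seriesFun (f : ℂ⟦X⟧) (z : ℂ) : ℂ := ∑' n, PowerSeries.coeff n f * z ^ n

/-! ### The weights -/

/-- The squared weights `βₘ²`: `β₀ = 1` and `βₘ₊₁² = βₘ² (m + 1) / (m + σ)`;
in particular `β₁² = 1 / σ`. -/
def weightSq (σ : ℝ) : ℕ → ℝ
  | 0 => 1
  | m + 1 => weightSq σ m * ((m + 1) / (m + σ))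

/-- The weights `βₘ`. -/
def weight (σ : ℝ) (m : ℕ) : ℝ := Real.sqrt (weightSq σ m)

theorem weightSq_pos {σ : ℝ} (hσ : 0 < σ) (m : ℕ) : 0 < weightSq σ m := by
  induction m with
  | zero => exact one_pos
  | succ m ih =>
    have h : (0 : ℝ) < (m + 1) / (m + σ) := by positivity
    exact mul_pos ih h

instance weight_pos (σ : ℝ) [hσ : Fact (0 < σ)] : Fact (∀ m, 0 < weight σ m) :=
  ⟨fun m => Real.sqrt_pos.mpr (weightSq_pos hσ.out m)⟩

/-- The Hilbert space `H_β` for the weights with parameter `σ`. -/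
abbrev Hardy (σ : ℝ) : Type := weightedHardy (weight σ)

/-- `H_β^k`: the elements of `H_β` whose `k`-th derivative is also in `H_β`. -/
def hardySobolev (σ : ℝ) (k : ℕ) : Submodule ℂ (Hardy σ) :=
  Submodule.comap
    (((PowerSeries.derivative (R := ℂ)).toLinearMap ^ k).comp (weightedHardy (weight σ)).subtype)
    (weightedHardy (weight σ))

/-! ### Differential expressions -/

/-- The differential expression `L = ∑_{k ≤ N} pₖ(z) Dᵏ`, applied to a function. -/
def diffExpr (N : ℕ) (p : ℕ → ℂ → ℂ) (f : ℂ → ℂ) (z : ℂ) : ℂ :=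
  ∑ k ∈ Finset.range (N + 1), p k z * iteratedDeriv k f z

/-- `L = ∑_{k ≤ N} pₖ(z) Dᵏ` is `𝔻`-regular (of order `N`): its coefficients are analytic on a
neighborhood of the closed unit disk and `p_N` does not vanish on the unit circle. -/
structure IsDiskRegular (N : ℕ) (p : ℕ → ℂ → ℂ) : Prop where
  analytic : ∀ k ≤ N, AnalyticOnNhd ℂ (p k) (Metric.closedBall 0 1)
  ne_zero : ∀ z : ℂ, ‖z‖ = 1 → p N z ≠ 0

/-- The number of zeros in the open unit disk, counted with multiplicity, of a function that is
analytic on a neighborhood of the closed disk and has no zero on the unit circle. -/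
def diskZeroCount (q : ℂ → ℂ) : ℕ :=
  ∑ᶠ z ∈ Metric.ball (0 : ℂ) 1, analyticOrderNatAt q z

/-! ### Fredholm operators -/

/-- A closed (unbounded) operator is Fredholm if its null space has finite dimension and its range
is closed and of finite codimension. -/
structure IsFredholmPMap {E : Type*} [NormedAddCommGroup E] [NormedSpace ℂ E]
    (T : E →ₗ.[ℂ] E) : Prop where
  closed : T.IsClosed
  finite_ker : FiniteDimensional ℂ (LinearMap.ker T.toFun)
  closed_range : IsClosed (LinearMap.range T.toFun : Set E)
  finite_coker : FiniteDimensional ℂ (E ⧸ LinearMap.range T.toFun)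

/-- The index `dim (null T) - codim (range T)` of a Fredholm operator. -/
def fredholmIndex {E : Type*} [NormedAddCommGroup E] [NormedSpace ℂ E]
    (T : E →ₗ.[ℂ] E) : ℤ :=
  (Module.finrank ℂ (LinearMap.ker T.toFun) : ℤ) -
    (Module.finrank ℂ (E ⧸ LinearMap.range T.toFun) : ℤ)

end

open scoped ENNReal PowerSeries
open Filter Topology

noncomputable section

/-! ### The index of a linear map that is bijective between subspaces of finite codimension -/

/-! Let `S` be integration from `0`. If the first `N` coefficients of `f` vanish and `g = Dᴺ f`,
then `f = Sᴺ g`, so `L f = (M + A S) g`, where `M` is multiplication by `p_N` and `A = ∑_{k<N} p_k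
S^(N-1-k)` is bounded.

The operator `M` has a bounded left inverse `E` with null space of dimension `K`: a factor `z - a`
with `|a| < 1` contributes one dimension, and a factor without zeros in the closed disk is
invertible (`exists_isLeftInverseOfDim_diskZeroCount`).

The term `A S` is compact. Concretely, if `P` removes the coefficients of index below a large `n`,
then `S P` has small norm, and a Neumann series gives `M' = M + A S P` a left inverse `E'` with the
same null space as `E` (`exists_isLeftInverseOfDim_add_tail`).

If the first `n` coefficients of `g` vanish, then `P g = g`, so `L Sᴺ g = M' g`. Hence `L` maps the
functions whose first `N + n` coefficients vanish bijectively onto the image under `M'` of those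
`g`. The former have codimension `N + n` in the domain; the latter form a closed subspace of
codimension `K + n`. The inverse `Sᴺ E'` is bounded. Adding finitely many dimensions preserves
closedness, and the index is `(N + n) - (K + n)` (`isFredholmPMap_of_bijective_ker`).

All norm estimates use only `βₙ₊₁ / βₙ → 1`: powers of the forward and backward shifts grow more
slowly than `ρᵏ` for every `ρ > 1`. -/

theorem exists_comp_eq_of_map_ker {V W F₁ F₂ : Type*} [AddCommGroup V] [Module ℂ V]
    [AddCommGroup W] [Module ℂ W] [AddCommGroup F₁] [Module ℂ F₁] [AddCommGroup F₂] [Module ℂ F₂]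
    (f : V →ₗ[ℂ] W) (φ : V →ₗ[ℂ] F₁) (ψ : W →ₗ[ℂ] F₂) (hφ : Function.Surjective φ)
    (hf : ∀ x, φ x = 0 → ψ (f x) = 0) :
    ∃ g : F₁ →ₗ[ℂ] F₂, ∀ x, g (φ x) = ψ (f x) := by
  obtain ⟨s, hs⟩ := φ.exists_rightInverse_of_surjective (LinearMap.range_eq_top.2 hφ)
  refine ⟨ψ ∘ₗ f ∘ₗ s, fun x => ?_⟩
  have h1 : φ (s (φ x)) = φ x := LinearMap.congr_fun hs (φ x)
  have h2 := hf (s (φ x) - x) (by rw [map_sub, h1, sub_self])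
  rw [map_sub, map_sub, sub_eq_zero] at h2
  exact h2

/-- Since `f` restricts to a bijection `ker φ → ker ψ`, it has the same kernel and cokernel as the
map `g : F₁ → F₂` that it induces (snake lemma). Rank-nullity for `g` gives the count. -/
theorem finrank_ker_add_eq {V W F₁ F₂ : Type*} [AddCommGroup V] [Module ℂ V]
    [AddCommGroup W] [Module ℂ W] [AddCommGroup F₁] [Module ℂ F₁] [AddCommGroup F₂] [Module ℂ F₂]
    [FiniteDimensional ℂ F₁] [FiniteDimensional ℂ F₂]
    (f : V →ₗ[ℂ] W) (φ : V →ₗ[ℂ] F₁) (ψ : W →ₗ[ℂ] F₂) (hφ : Function.Surjective φ)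
    (hψ : Function.Surjective ψ) (hf : ∀ x, φ x = 0 → ψ (f x) = 0)
    (hinj : ∀ x, φ x = 0 → f x = 0 → x = 0) (hsurj : ∀ y, ψ y = 0 → ∃ x, φ x = 0 ∧ f x = y) :
    FiniteDimensional ℂ (LinearMap.ker f) ∧ FiniteDimensional ℂ (W ⧸ LinearMap.range f) ∧
      Module.finrank ℂ (LinearMap.ker f) + Module.finrank ℂ F₂ =
        Module.finrank ℂ F₁ + Module.finrank ℂ (W ⧸ LinearMap.range f) := by
  obtain ⟨g, hg⟩ := exists_comp_eq_of_map_ker f φ ψ hφ hf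
  have hmem : ∀ x : LinearMap.ker f, φ x ∈ LinearMap.ker g := fun x => by
    rw [LinearMap.mem_ker, hg, LinearMap.mem_ker.1 x.2, map_zero]
  let e₁ : LinearMap.ker f →ₗ[ℂ] LinearMap.ker g :=
    (φ ∘ₗ (LinearMap.ker f).subtype).codRestrict _ hmem
  have he₁ : Function.Bijective e₁ := by
    constructor
    · refine (injective_iff_map_eq_zero e₁).2 fun x hx => ?_
      exact Subtype.ext (hinj x (congrArg Subtype.val hx) x.2)
    · rintro ⟨u, hu⟩
      obtain ⟨x, rfl⟩ := hφ u
      obtain ⟨x', hx', hfx'⟩ := hsurj (f x) (by rw [← hg]; exact hu)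
      refine ⟨⟨x - x', by rw [LinearMap.mem_ker, map_sub, hfx', sub_self]⟩, Subtype.ext ?_⟩
      change φ (x - x') = φ x
      rw [map_sub, hx', sub_zero]
  let q : W →ₗ[ℂ] F₂ ⧸ LinearMap.range g := (LinearMap.range g).mkQ ∘ₗ ψ
  have hq : Function.Surjective q := ((LinearMap.range g).mkQ_surjective).comp hψ
  have hker : LinearMap.ker q = LinearMap.range f := by
    ext w
    rw [LinearMap.mem_ker]
    change (LinearMap.range g).mkQ (ψ w) = 0 ↔ _
    rw [Submodule.mkQ_apply, Submodule.Quotient.mk_eq_zero]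
    constructor
    · rintro ⟨u, hu⟩
      obtain ⟨x, rfl⟩ := hφ u
      rw [hg] at hu
      obtain ⟨x', -, hx'⟩ := hsurj (w - f x) (by rw [map_sub, hu, sub_self])
      exact ⟨x' + x, by rw [map_add, hx', sub_add_cancel]⟩
    · rintro ⟨x, rfl⟩
      exact ⟨φ x, hg x⟩
  have E₁ := LinearEquiv.ofBijective e₁ he₁
  have E₂ : (W ⧸ LinearMap.range f) ≃ₗ[ℂ] F₂ ⧸ LinearMap.range g :=
    (Submodule.quotEquivOfEq _ _ hker.symm).trans (q.quotKerEquivOfSurjective hq)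
  refine ⟨E₁.symm.finiteDimensional, E₂.symm.finiteDimensional, ?_⟩
  rw [E₁.finrank_eq, E₂.finrank_eq, ← (LinearMap.range g).finrank_quotient_add_finrank,
    ← g.finrank_range_add_finrank_ker]
  ring

/-- The bounded operator `R` inverts `T` from `ker ψ` back to `ker φ`. This makes the graph over
`ker φ` closed; the full graph and the full range are images of a space in which `ker φ` has finite
codimension, so they are closed too. -/
theorem isFredholmPMap_of_bijective_ker {E F₁ F₂ : Type*} [NormedAddCommGroup E] [NormedSpace ℂ E]
    [AddCommGroup F₁] [Module ℂ F₁] [AddCommGroup F₂] [Module ℂ F₂]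
    [FiniteDimensional ℂ F₁] [FiniteDimensional ℂ F₂] (T : E →ₗ.[ℂ] E)
    (φ : T.domain →ₗ[ℂ] F₁) (ψ : E →ₗ[ℂ] F₂) (R : E →L[ℂ] E) (hφ : Function.Surjective φ)
    (hψ : Function.Surjective ψ) (hclosed : IsClosed (LinearMap.ker ψ : Set E))
    (hT : ∀ x, φ x = 0 → ψ (T x) = 0 ∧ R (T x) = x)
    (hsurj : ∀ y, ψ y = 0 → ∃ x, φ x = 0 ∧ T x = y) :
    IsFredholmPMap T ∧
      fredholmIndex T = (Module.finrank ℂ F₁ : ℤ) - (Module.finrank ℂ F₂ : ℤ) := by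
  have hinj : ∀ x, φ x = 0 → T.toFun x = 0 → x = 0 := fun x hx h0 => by
    have h := (hT x hx).2
    rw [show T x = 0 from h0, map_zero] at h
    exact Subtype.ext h.symm
  obtain ⟨h1, h2, h3⟩ := finrank_ker_add_eq T.toFun φ ψ hφ hψ (fun x hx => (hT x hx).1) hinj hsurj
  have hco : (LinearMap.ker φ).CoFG :=
    (φ.quotKerEquivOfSurjective hφ).symm.finiteDimensional
  refine ⟨⟨?_, h1, ?_, h2⟩, ?_⟩
  · let G : T.domain →ₗ[ℂ] E × E := T.domain.subtype.prod T.toFun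
    have hG : (T.graph : Set (E × E)) = LinearMap.range G := by
      ext ⟨a, b⟩
      simp only [SetLike.mem_coe, LinearPMap.mem_graph_iff, LinearMap.mem_range]
      constructor
      · rintro ⟨y, rfl, rfl⟩
        exact ⟨y, rfl⟩
      · rintro ⟨y, hy⟩
        exact ⟨y, congrArg Prod.fst hy, congrArg Prod.snd hy⟩
    change IsClosed (T.graph : Set (E × E))
    rw [hG]
    refine LinearMap.isClosed_range_of_isClosed_map_of_finiteDimensional_quotient
      (s := LinearMap.ker φ) ?_
    -- Over `ker φ` the graph is cut out by two continuous conditions, `ψ b = 0` and `a = R b`.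
    have hmap : ((LinearMap.ker φ).map G : Set (E × E)) =
        {z | z.2 ∈ (LinearMap.ker ψ : Set E)} ∩ {z | z.1 = R z.2} := by
      ext ⟨a, b⟩
      constructor
      · rintro ⟨x, hx, hxG⟩
        obtain ⟨rfl, rfl⟩ : (x : E) = a ∧ T x = b :=
          ⟨congrArg Prod.fst hxG, congrArg Prod.snd hxG⟩
        exact ⟨(hT x hx).1, (hT x hx).2.symm⟩
      · rintro ⟨hb, ha⟩
        obtain ⟨x, hx, rfl⟩ := hsurj b hb
        refine ⟨x, hx, Prod.ext ?_ rfl⟩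
        exact (hT x hx).2.symm.trans ha.symm
    rw [hmap]
    exact (hclosed.preimage continuous_snd).inter
      (isClosed_eq continuous_fst (R.continuous.comp continuous_snd))
  · refine LinearMap.isClosed_range_of_isClosed_map_of_finiteDimensional_quotient
      (s := LinearMap.ker φ) ?_
    have hmap : (LinearMap.ker φ).map T.toFun = LinearMap.ker ψ := by
      ext y
      constructor
      · rintro ⟨x, hx, rfl⟩
        exact (hT x hx).1
      · intro hy
        obtain ⟨x, hx, h⟩ := hsurj y hy
        exact ⟨x, hx, h⟩
    rw [hmap]
    exact hclosed
  · unfold fredholmIndex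
    omega

/-! ### Coefficient operators on weighted Hardy spaces -/

/-- From some index `J` on, every ratio is below `ρ` and `C = 1` works. Descending from `J` one
starting index at a time, the constant is enlarged finitely often. -/
theorem exists_shift_bound {w : ℕ → ℝ} (hw : ∀ n, 0 < w n)
    (hlim : Tendsto (fun n => w (n + 1) / w n) atTop (𝓝 1)) {ρ : ℝ} (hρ : 1 < ρ) :
    ∃ C, 0 < C ∧ ∀ m k, w (m + k) ≤ C * ρ ^ k * w m := by
  obtain ⟨J, hJ⟩ := eventually_atTop.1 (hlim.eventually (gt_mem_nhds hρ))
  have hρ0 : 0 < ρ := one_pos.trans hρ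
  suffices h : ∀ i ≤ J, ∃ C, 0 < C ∧ ∀ m, J - i ≤ m → ∀ k, w (m + k) ≤ C * ρ ^ k * w m by
    obtain ⟨C, hC, h⟩ := h J le_rfl
    exact ⟨C, hC, fun m => h m (by omega)⟩
  intro i
  induction i with
  | zero =>
    refine fun _ => ⟨1, one_pos, fun m hm k => ?_⟩
    induction k with
    | zero => simp
    | succ k ih =>
      have h1 := (div_lt_iff₀ (hw (m + k))).1 (hJ (m + k) (by omega))
      calc w (m + (k + 1)) ≤ ρ * w (m + k) := h1.le
        _ ≤ ρ * (1 * ρ ^ k * w m) := by gcongr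
        _ = 1 * ρ ^ (k + 1) * w m := by ring
  | succ i ih =>
    intro hi
    obtain ⟨C, hC, h⟩ := ih (by omega)
    set m₀ := J - (i + 1) with hm₀
    -- The entries cover `k = 0`, the starting indices already treated, and the new index `m₀`, from
    -- which one step leads to `m₀ + 1`.
    refine ⟨max 1 (max C (C * w (m₀ + 1) / w m₀)), by positivity, fun m hm k => ?_⟩
    have hwm := hw m
    rcases hm.eq_or_lt with rfl | hlt
    · cases k with
      | zero => simpa using le_mul_of_one_le_left hwm.le (le_max_left _ _)
      | succ k =>
        have h1 := h (m₀ + 1) (by omega) k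
        rw [show m₀ + 1 + k = m₀ + (k + 1) by ring] at h1
        refine h1.trans ?_
        have hle : C * w (m₀ + 1) / w m₀ ≤ max 1 (max C (C * w (m₀ + 1) / w m₀)) :=
          (le_max_right _ _).trans (le_max_right _ _)
        have hle' : ρ ^ k ≤ ρ ^ (k + 1) := pow_le_pow_right₀ hρ.le (Nat.le_succ k)
        calc C * ρ ^ k * w (m₀ + 1) = C * w (m₀ + 1) / w m₀ * ρ ^ k * w m₀ := by
              field_simp
          _ ≤ _ := by gcongr
    · refine (h m (by omega) k).trans ?_
      have hle : C ≤ max 1 (max C (C * w (m₀ + 1) / w m₀)) :=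
          (le_max_left _ _).trans (le_max_right _ _)
      gcongr

/-- Positive weights with `βₙ₊₁ / βₙ → 1`. -/
class RegularWeight (β : ℕ → ℝ) [Fact (∀ n, 0 < β n)] : Prop where
  tendsto_ratio : Tendsto (fun n => β (n + 1) / β n) atTop (𝓝 1)

namespace weightedHardy

section
variable {β : ℕ → ℝ}

theorem mem_of_sum_le {f : ℂ⟦X⟧} {D : ℝ}
    (h : ∀ s : Finset ℕ, ∑ n ∈ s, ‖(β n : ℂ) * PowerSeries.coeff n f‖ ^ 2 ≤ D) :
    f ∈ weightedHardy β := by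
  refine memℓp_gen' (C := D) fun s => ?_
  simpa only [ENNReal.toReal_ofNat, Real.rpow_ofNat] using h s

theorem summable_sq {f : ℂ⟦X⟧} (hf : f ∈ weightedHardy β) :
    Summable fun n => ‖(β n : ℂ) * PowerSeries.coeff n f‖ ^ 2 := by
  have h := (memℓp_gen_iff (p := 2) (by norm_num)).1 (show Memℓp _ 2 from hf)
  simpa only [ENNReal.toReal_ofNat, Real.rpow_ofNat] using h

theorem mem_of_finite {f : ℂ⟦X⟧} {m : ℕ} (h : ∀ n, m ≤ n → PowerSeries.coeff n f = 0) :
    f ∈ weightedHardy β := by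
  refine memℓp_gen (summable_of_ne_finset_zero (s := Finset.range m) fun n hn => ?_)
  rw [h n (by simpa using hn)]
  simp

variable [hβ : Fact (∀ n, 0 < β n)]

theorem norm_sq_eq_tsum (f : weightedHardy β) :
    ‖f‖ ^ 2 = ∑' n, ‖(β n : ℂ) * PowerSeries.coeff n (f : ℂ⟦X⟧)‖ ^ 2 := by
  rw [weightedHardy.norm_sq_eq]
  refine tsum_congr fun n => ?_
  rw [norm_mul, Complex.norm_real, mul_pow, Real.norm_eq_abs, sq_abs, mul_comm]

theorem norm_le_of_sum_le {f : weightedHardy β} {D : ℝ} (hD : 0 ≤ D)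
    (h : ∀ s : Finset ℕ, ∑ n ∈ s, ‖(β n : ℂ) * PowerSeries.coeff n (f : ℂ⟦X⟧)‖ ^ 2 ≤ D ^ 2) :
    ‖f‖ ≤ D := by
  refine le_of_sq_le_sq ?_ hD
  rw [norm_sq_eq_tsum]
  exact (summable_sq f.2).tsum_le_of_sum_le h

theorem sum_le_norm_sq (f : weightedHardy β) (s : Finset ℕ) :
    ∑ n ∈ s, ‖(β n : ℂ) * PowerSeries.coeff n (f : ℂ⟦X⟧)‖ ^ 2 ≤ ‖f‖ ^ 2 := by
  rw [norm_sq_eq_tsum]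
  exact (summable_sq f.2).sum_le_tsum s fun _ _ => by positivity

theorem norm_coeff_le (f : weightedHardy β) (n : ℕ) :
    ‖PowerSeries.coeff n (f : ℂ⟦X⟧)‖ ≤ ‖f‖ / β n := by
  have h := sum_le_norm_sq f {n}
  rw [Finset.sum_singleton, norm_mul, Complex.norm_real, Real.norm_of_nonneg (hβ.out n).le] at h
  rw [le_div_iff₀ (hβ.out n), mul_comm]
  exact le_of_sq_le_sq h (norm_nonneg f)

/-- The `n`-th coefficient as a continuous linear functional. -/
def coeffL (β : ℕ → ℝ) [hβ : Fact (∀ n, 0 < β n)] (n : ℕ) : weightedHardy β →L[ℂ] ℂ :=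
  LinearMap.mkContinuous ((PowerSeries.coeff n).comp (weightedHardy β).subtype) (β n)⁻¹
    fun f => (norm_coeff_le f n).trans_eq (by rw [div_eq_inv_mul])

@[simp] theorem coeffL_apply (n : ℕ) (f : weightedHardy β) :
    coeffL β n f = PowerSeries.coeff n (f : ℂ⟦X⟧) := rfl

theorem ext_coeff {f g : weightedHardy β} (h : ∀ n, coeffL β n f = coeffL β n g) : f = g :=
  Subtype.ext (PowerSeries.ext h)

theorem toLp_surjective : Function.Surjective (weightedHardy.toLp β) := by
  intro u
  have h : ∀ n, (β n : ℂ) * PowerSeries.coeff n (PowerSeries.mk fun n => (β n : ℂ)⁻¹ * u n) =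
      u n := fun n => by
    rw [PowerSeries.coeff_mk, mul_inv_cancel_left₀ (Complex.ofReal_ne_zero.mpr (hβ.out n).ne')]
  refine ⟨⟨PowerSeries.mk fun n => (β n : ℂ)⁻¹ * u n, ?_⟩, lp.ext (funext h)⟩
  change Memℓp _ 2
  simpa only [h] using lp.memℓp u

instance : CompleteSpace (weightedHardy β) := by
  let e : weightedHardy β ≃ₗᵢ[ℂ] lp (fun _ : ℕ => ℂ) 2 :=
    { LinearEquiv.ofBijective (weightedHardy.toLp β)
        ⟨weightedHardy.toLp_injective β, toLp_surjective⟩ with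
      norm_map' := fun _ => rfl }
  exact e.toIsometryEquiv.completeSpace_iff.2 inferInstance

/-- One construction for shifts, tail projections and integration. Injectivity of `e` is asked only
where `m` is nonzero, so the collisions caused by truncated subtraction do no harm. -/
theorem exists_coeffOp (e : ℕ → ℕ) (m : ℕ → ℂ) {C : ℝ} (hC : 0 ≤ C)
    (he : Set.InjOn e {n | m n ≠ 0}) (hm : ∀ n, m n ≠ 0 → ‖m n‖ * β n ≤ C * β (e n)) :
    ∃ A : weightedHardy β →L[ℂ] weightedHardy β,
      (∀ f n, coeffL β n (A f) = m n * coeffL β (e n) f) ∧ ‖A‖ ≤ C := by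
  let F : weightedHardy β →ₗ[ℂ] ℂ⟦X⟧ :=
    { toFun := fun f => PowerSeries.mk fun n => m n * coeffL β (e n) f
      map_add' := fun f g => by ext n; simp [mul_add]
      map_smul' := fun c f => by ext n; simp [mul_left_comm] }
  have hF : ∀ f (s : Finset ℕ),
      ∑ n ∈ s, ‖(β n : ℂ) * PowerSeries.coeff n (F f)‖ ^ 2 ≤ (C * ‖f‖) ^ 2 := by
    intro f s
    have hF' : ∀ n, PowerSeries.coeff n (F f) = m n * PowerSeries.coeff (e n) (f : ℂ⟦X⟧) :=
      fun n => PowerSeries.coeff_mk n fun n => m n * coeffL β (e n) f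
    rw [← Finset.sum_filter_of_ne (p := fun n => m n ≠ 0)]
    · calc ∑ n ∈ s with m n ≠ 0, ‖(β n : ℂ) * PowerSeries.coeff n (F f)‖ ^ 2
          ≤ ∑ n ∈ s with m n ≠ 0,
              C ^ 2 * ‖(β (e n) : ℂ) * PowerSeries.coeff (e n) (f : ℂ⟦X⟧)‖ ^ 2 := by
            refine Finset.sum_le_sum fun n hn => ?_
            rw [← mul_pow, hF', norm_mul, norm_mul, norm_mul, Complex.norm_real, Complex.norm_real,
              Real.norm_of_nonneg (hβ.out _).le, Real.norm_of_nonneg (hβ.out _).le]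
            have hβn := hβ.out n
            have h := hm n (Finset.mem_filter.1 hn).2
            refine pow_le_pow_left₀ (by positivity) ?_ 2
            calc β n * (‖m n‖ * ‖PowerSeries.coeff (e n) (f : ℂ⟦X⟧)‖)
                = ‖m n‖ * β n * ‖PowerSeries.coeff (e n) (f : ℂ⟦X⟧)‖ := by ring
              _ ≤ C * β (e n) * ‖PowerSeries.coeff (e n) (f : ℂ⟦X⟧)‖ := by gcongr
              _ = _ := by ring
        _ = C ^ 2 * ∑ n ∈ (s.filter fun n => m n ≠ 0).image e,
              ‖(β n : ℂ) * PowerSeries.coeff n (f : ℂ⟦X⟧)‖ ^ 2 := by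
            rw [← Finset.mul_sum, Finset.sum_image]
            intro a ha b hb hab
            exact he (Finset.mem_filter.1 ha).2 (Finset.mem_filter.1 hb).2 hab
        _ ≤ C ^ 2 * ‖f‖ ^ 2 := by gcongr; exact sum_le_norm_sq f _
        _ = _ := by ring
    · intro n _ hn h0
      exact hn (by rw [hF', h0]; simp)
  refine ⟨(F.codRestrict _ fun f => mem_of_sum_le (hF f)).mkContinuous C fun f =>
    norm_le_of_sum_le (by positivity) (hF f), fun f n =>
      PowerSeries.coeff_mk n fun n => m n * coeffL β (e n) f,
    LinearMap.mkContinuous_norm_le _ hC _⟩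

/-- The projection that removes the coefficients of index less than `n`. -/
theorem exists_tail (n : ℕ) : ∃ A : weightedHardy β →L[ℂ] weightedHardy β,
    ∀ f i, coeffL β i (A f) = if i < n then 0 else coeffL β i f := by
  obtain ⟨A, hA, -⟩ := exists_coeffOp (β := β) id (fun i => if i < n then 0 else 1) zero_le_one
    Function.injective_id.injOn (fun i hi => by
      have hi' : ¬ i < n := fun h => hi (if_pos h)
      simp [hi'])
  refine ⟨A, fun f i => (hA f i).trans ?_⟩
  split_ifs <;> simp

end

section
variable {β : ℕ → ℝ} [hβ : Fact (∀ n, 0 < β n)] [RegularWeight β]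

theorem exists_forward_bound {ρ : ℝ} (hρ : 1 < ρ) :
    ∃ C, 0 < C ∧ ∀ m k, β (m + k) ≤ C * ρ ^ k * β m :=
  exists_shift_bound hβ.out RegularWeight.tendsto_ratio hρ

theorem exists_backward_bound {ρ : ℝ} (hρ : 1 < ρ) :
    ∃ C, 0 < C ∧ ∀ m k, β m ≤ C * ρ ^ k * β (m + k) := by
  have h := (RegularWeight.tendsto_ratio (β := β)).inv₀ one_ne_zero
  rw [inv_one] at h
  obtain ⟨C, hC, hb⟩ := exists_shift_bound (w := fun n => (β n)⁻¹)
    (fun n => inv_pos.2 (hβ.out n)) (h.congr fun n => by rw [inv_div, inv_div_inv]) hρ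
  refine ⟨C, hC, fun m k => ?_⟩
  have h1 := hb m k
  have hm := hβ.out m
  have hmk := hβ.out (m + k)
  rw [inv_le_iff_one_le_mul₀ hmk] at h1
  calc β m = 1 * β m := (one_mul _).symm
    _ ≤ C * ρ ^ k * (β m)⁻¹ * β (m + k) * β m := by gcongr
    _ = C * ρ ^ k * β (m + k) := by field_simp

theorem exists_shift_pow {ρ : ℝ} (hρ : 1 < ρ) : ∃ C, 0 < C ∧ ∀ k,
    ∃ A : weightedHardy β →L[ℂ] weightedHardy β,
      (∀ f n, coeffL β n (A f) = if n < k then 0 else coeffL β (n - k) f) ∧ ‖A‖ ≤ C * ρ ^ k := by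
  obtain ⟨C, hC, h⟩ := exists_forward_bound (β := β) hρ
  refine ⟨C, hC, fun k => ?_⟩
  have hρ0 : 0 < ρ := one_pos.trans hρ
  obtain ⟨A, hA, hA'⟩ := exists_coeffOp (β := β) (fun n => n - k) (fun n => if n < k then 0 else 1)
    (C := C * ρ ^ k) (by positivity) (by
      intro a ha b hb hab
      have ha' : ¬ a < k := fun h => ha (if_pos h)
      have hb' : ¬ b < k := fun h => hb (if_pos h)
      have : a - k = b - k := hab
      omega) (fun n hn => by
      have hn' : ¬ n < k := fun h => hn (if_pos h)
      have h1 := h (n - k) k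
      rw [Nat.sub_add_cancel (by omega)] at h1
      simpa [hn'] using h1)
  refine ⟨A, fun f n => (hA f n).trans ?_, hA'⟩
  split_ifs <;> simp

theorem exists_backward_pow {ρ : ℝ} (hρ : 1 < ρ) : ∃ C, 0 < C ∧ ∀ k,
    ∃ A : weightedHardy β →L[ℂ] weightedHardy β,
      (∀ f n, coeffL β n (A f) = coeffL β (n + k) f) ∧ ‖A‖ ≤ C * ρ ^ k := by
  obtain ⟨C, hC, h⟩ := exists_backward_bound (β := β) hρ
  refine ⟨C, hC, fun k => ?_⟩
  have hρ0 : 0 < ρ := one_pos.trans hρ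
  obtain ⟨A, hA, hA'⟩ := exists_coeffOp (β := β) (fun n => n + k) (fun _ => 1)
    (C := C * ρ ^ k) (by positivity) (add_left_injective k).injOn (fun n _ => by
      simpa using h n k)
  exact ⟨A, fun f n => (hA f n).trans (one_mul _), hA'⟩

/-- At `n = 0` the convention `0⁻¹ = 0` makes the constant term of `S f` vanish. -/
theorem exists_integration : ∃ S : weightedHardy β →L[ℂ] weightedHardy β,
    ∀ f n, coeffL β n (S f) = (n : ℂ)⁻¹ * coeffL β (n - 1) f := by
  obtain ⟨C, hC, h⟩ := exists_forward_bound (β := β) one_lt_two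
  obtain ⟨S, hS, -⟩ := exists_coeffOp (β := β) (fun n => n - 1) (fun n => (n : ℂ)⁻¹)
    (C := C * 2 ^ 1) (by positivity) (by
      intro a ha b hb hab
      have ha' : a ≠ 0 := by rintro rfl; simp at ha
      have hb' : b ≠ 0 := by rintro rfl; simp at hb
      have : a - 1 = b - 1 := hab
      omega) (fun n hn => by
      have hn' : n ≠ 0 := by rintro rfl; simp at hn
      have h1 := h (n - 1) 1
      rw [Nat.sub_add_cancel (by omega)] at h1
      refine le_trans (mul_le_of_le_one_left (hβ.out n).le ?_) h1
      rw [norm_inv, Complex.norm_natCast]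
      exact inv_le_one_of_one_le₀ (by exact_mod_cast Nat.one_le_iff_ne_zero.2 hn'))
  exact ⟨S, hS⟩

/-- This is the compactness of `S` in quantitative form: on tails the multipliers `1 / i` are at
most `1 / n`, while the shift costs a fixed constant. -/
theorem exists_norm_integration_tail_le (S : weightedHardy β →L[ℂ] weightedHardy β)
    (hS : ∀ f n, coeffL β n (S f) = (n : ℂ)⁻¹ * coeffL β (n - 1) f) {ε : ℝ} (hε : 0 < ε) :
    ∃ (n : ℕ) (P : weightedHardy β →L[ℂ] weightedHardy β),
      (∀ f i, coeffL β i (P f) = if i < n then 0 else coeffL β i f) ∧ ‖S ∘L P‖ ≤ ε := by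
  obtain ⟨C, hC, h⟩ := exists_forward_bound (β := β) one_lt_two
  obtain ⟨n, hn⟩ := exists_nat_gt (C * 2 ^ 1 / ε)
  have hn0 : (0 : ℝ) < n := lt_trans (by positivity) hn
  obtain ⟨P, hP⟩ := exists_tail (β := β) n
  refine ⟨n, P, hP, ?_⟩
  -- The cutoff is `i ≤ n` although `P` removes only indices below `n`, because `S` raises the index
  -- by one.
  obtain ⟨A, hA, hA'⟩ := exists_coeffOp (β := β) (fun i => i - 1)
    (fun i => if i ≤ n then 0 else (i : ℂ)⁻¹) (C := ε) hε.le (by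
      intro a ha b hb hab
      have ha' : ¬ a ≤ n := fun h => ha (if_pos h)
      have hb' : ¬ b ≤ n := fun h => hb (if_pos h)
      have : a - 1 = b - 1 := hab
      omega) (fun i hi => by
      have hi' : ¬ i ≤ n := fun h => hi (if_pos h)
      have h1 := h (i - 1) 1
      rw [Nat.sub_add_cancel (by omega)] at h1
      rw [if_neg hi', norm_inv, Complex.norm_natCast]
      have hin : (n : ℝ) ≤ i := by exact_mod_cast (not_le.1 hi').le
      have hb := hβ.out (i - 1)
      have h2 : C * 2 ^ 1 ≤ ε * i :=
        (((div_lt_iff₀ hε).1 hn).le.trans_eq (mul_comm _ _)).trans (by gcongr)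
      rw [inv_mul_le_iff₀ (hn0.trans_le hin)]
      calc β i ≤ C * 2 ^ 1 * β (i - 1) := h1
        _ ≤ ε * i * β (i - 1) := by gcongr
        _ = _ := by ring)
  have hSA : S ∘L P = A := by
    ext1 f
    refine ext_coeff fun i => ?_
    rw [ContinuousLinearMap.comp_apply, hS, hP, hA]
    rcases Nat.eq_zero_or_pos i with rfl | hi
    · simp
    · by_cases hin : i ≤ n
      · rw [if_pos (by omega), if_pos hin]; simp
      · rw [if_neg (by omega), if_neg hin]
  rw [hSA]
  exact hA'

end

end weightedHardy

/-! ### Power series that converge on the unit disk -/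

/-- The coefficients of `c` decay geometrically, so that the series converges on a neighborhood of
the closed unit disk. -/
def OverConvergent (c : ℂ⟦X⟧) : Prop :=
  ∃ r C : ℝ, 0 < r ∧ r < 1 ∧ ∀ n, ‖PowerSeries.coeff n c‖ ≤ C * r ^ n

/-- The series converges absolutely on the open unit disk. -/
def DiskSummable (f : ℂ⟦X⟧) : Prop :=
  ∀ r : ℝ, 0 ≤ r → r < 1 → Summable fun n => ‖PowerSeries.coeff n f‖ * r ^ n

theorem OverConvergent.diskSummable {c : ℂ⟦X⟧} (hc : OverConvergent c) : DiskSummable c := by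
  obtain ⟨ρ, C, hρ0, hρ, h⟩ := hc
  intro r hr0 hr
  refine Summable.of_nonneg_of_le (fun n => by positivity) (fun n => ?_)
    ((summable_geometric_of_lt_one (mul_nonneg hρ0.le hr0) (mul_lt_one_of_nonneg_of_lt_one_left
      hρ0.le hρ hr.le)).mul_left C)
  calc _ ≤ C * ρ ^ n * r ^ n := by gcongr; exact h n
    _ = _ := by rw [mul_pow, mul_assoc]

namespace DiskSummable

theorem summable_norm {f : ℂ⟦X⟧} (hf : DiskSummable f) {z : ℂ} (hz : ‖z‖ < 1) :
    Summable fun n => ‖PowerSeries.coeff n f * z ^ n‖ := by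
  simpa only [norm_mul, norm_pow] using hf ‖z‖ (norm_nonneg z) hz

theorem hasSum {f : ℂ⟦X⟧} (hf : DiskSummable f) {z : ℂ} (hz : ‖z‖ < 1) :
    HasSum (fun n => PowerSeries.coeff n f * z ^ n) (seriesFun f z) :=
  (hf.summable_norm hz).of_norm.hasSum

theorem hasFPowerSeriesAt {f : ℂ⟦X⟧} (hf : DiskSummable f) :
    HasFPowerSeriesAt (seriesFun f)
      (FormalMultilinearSeries.ofScalars ℂ fun n => PowerSeries.coeff n f) 0 := by
  rw [hasFPowerSeriesAt_iff]
  filter_upwards [Metric.ball_mem_nhds (0 : ℂ) one_pos] with z hz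
  simp only [FormalMultilinearSeries.coeff_ofScalars, zero_add, smul_eq_mul]
  simpa only [mul_comm] using hf.hasSum (mem_ball_zero_iff.1 hz)

theorem eq_of_seriesFun_eq {f g : ℂ⟦X⟧} (hf : DiskSummable f) (hg : DiskSummable g)
    (h : ∀ z : ℂ, ‖z‖ < 1 → seriesFun f z = seriesFun g z) : f = g := by
  have h1 := hf.hasFPowerSeriesAt.eq_formalMultilinearSeries
    (hg.hasFPowerSeriesAt.congr (by
      filter_upwards [Metric.ball_mem_nhds (0 : ℂ) one_pos] with z hz
      exact (h z (mem_ball_zero_iff.1 hz)).symm))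
  exact PowerSeries.ext fun n =>
    congrFun (FormalMultilinearSeries.ofScalars_series_injective ℂ ℂ h1) n

theorem seriesFun_mul {f g : ℂ⟦X⟧} (hf : DiskSummable f) (hg : DiskSummable g) {z : ℂ}
    (hz : ‖z‖ < 1) : seriesFun (f * g) z = seriesFun f z * seriesFun g z := by
  rw [seriesFun, seriesFun, seriesFun, tsum_mul_tsum_eq_tsum_sum_antidiagonal_of_summable_norm
    (hf.summable_norm hz) (hg.summable_norm hz)]
  refine tsum_congr fun n => ?_
  rw [PowerSeries.coeff_mul, Finset.sum_mul]
  refine Finset.sum_congr rfl fun x hx => ?_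
  rw [← Finset.HasAntidiagonal.mem_antidiagonal.1 hx, pow_add]
  ring

theorem mul {f g : ℂ⟦X⟧} (hf : DiskSummable f) (hg : DiskSummable g) : DiskSummable (f * g) := by
  intro r hr0 hr
  have hr' : ‖(r : ℂ)‖ < 1 := by rwa [Complex.norm_real, Real.norm_of_nonneg hr0]
  have h := summable_norm_sum_mul_antidiagonal_of_summable_norm
    (hf.summable_norm hr') (hg.summable_norm hr')
  refine h.congr fun n => ?_
  rw [PowerSeries.coeff_mul]
  have h1 : ∑ x ∈ Finset.HasAntidiagonal.antidiagonal n, PowerSeries.coeff x.1 f * (r : ℂ) ^ x.1 *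
      (PowerSeries.coeff x.2 g * (r : ℂ) ^ x.2) =
      (∑ x ∈ Finset.HasAntidiagonal.antidiagonal n,
        PowerSeries.coeff x.1 f * PowerSeries.coeff x.2 g) *
        (r : ℂ) ^ n := by
    rw [Finset.sum_mul]
    refine Finset.sum_congr rfl fun x hx => ?_
    rw [← Finset.HasAntidiagonal.mem_antidiagonal.1 hx, pow_add]
    ring
  rw [h1, norm_mul, norm_pow, Complex.norm_real, Real.norm_of_nonneg hr0]

theorem seriesFun_sum {ι : Type*} (s : Finset ι) {f : ι → ℂ⟦X⟧} (hf : ∀ i ∈ s, DiskSummable (f i))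
    {z : ℂ} (hz : ‖z‖ < 1) : seriesFun (∑ i ∈ s, f i) z = ∑ i ∈ s, seriesFun (f i) z := by
  refine HasSum.tsum_eq ?_
  have h := hasSum_sum fun i hi => (hf i hi).hasSum hz
  simpa only [map_sum, Finset.sum_mul] using h

theorem hasDerivAt {f : ℂ⟦X⟧} (hf : DiskSummable f)
    (hf' : DiskSummable (PowerSeries.derivative ℂ f)) {z : ℂ} (hz : ‖z‖ < 1) :
    HasDerivAt (seriesFun f) (seriesFun (PowerSeries.derivative ℂ f) z) z := by
  obtain ⟨r, hzr, hr⟩ := exists_between hz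
  have hr0 : 0 ≤ r := (norm_nonneg z).trans hzr.le
  have hmem : z ∈ Metric.ball (0 : ℂ) r := mem_ball_zero_iff.2 hzr
  have h := hasDerivAt_tsum_of_isPreconnected
    (g := fun n z => PowerSeries.coeff n f * z ^ n)
    (g' := fun n z => PowerSeries.coeff n f * ((n : ℂ) * z ^ (n - 1)))
    (u := fun n => ‖PowerSeries.coeff n f‖ * (n * r ^ (n - 1)))
    -- The majorant is the series of `f'` at radius `r`, shifted by one index.
    ((summable_nat_add_iff 1).1 ((hf' r hr0 hr).congr fun n => by
      rw [PowerSeries.coeff_derivative, norm_mul, Nat.add_sub_cancel, mul_assoc]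
      norm_cast))
    Metric.isOpen_ball (convex_ball (0 : ℂ) r).isPreconnected
    (fun n y _ => (hasDerivAt_pow n y).const_mul _)
    (fun n y hy => by
      rw [norm_mul, norm_mul, norm_pow, Complex.norm_natCast]
      have := (mem_ball_zero_iff.1 hy).le
      gcongr)
    hmem (hf.hasSum hz).summable hmem
  convert! h using 1
  have hs : Summable fun n => PowerSeries.coeff n f * ((n : ℂ) * z ^ (n - 1)) := by
    refine (summable_nat_add_iff 1).1 ((hf'.hasSum hz).summable.congr fun n => ?_)
    rw [PowerSeries.coeff_derivative, Nat.add_sub_cancel]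
    push_cast
    ring
  rw [hs.tsum_eq_zero_add]
  simp only [Nat.cast_zero, zero_mul, mul_zero, zero_add, Nat.add_sub_cancel]
  refine tsum_congr fun n => ?_
  rw [PowerSeries.coeff_derivative]
  push_cast
  ring

theorem iteratedDeriv_eq {f : ℂ⟦X⟧} {N : ℕ}
    (hf : ∀ k ≤ N, DiskSummable ((PowerSeries.derivative ℂ)^[k] f)) :
    ∀ k ≤ N, ∀ z : ℂ, ‖z‖ < 1 →
      iteratedDeriv k (seriesFun f) z = seriesFun ((PowerSeries.derivative ℂ)^[k] f) z := by
  intro k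
  induction k with
  | zero => intro _ z _; simp
  | succ k ih =>
    intro hk z hz
    rw [iteratedDeriv_succ, Function.iterate_succ_apply']
    have h : iteratedDeriv k (seriesFun f) =ᶠ[𝓝 z]
        seriesFun ((PowerSeries.derivative ℂ)^[k] f) := by
      filter_upwards [Metric.isOpen_ball.mem_nhds (mem_ball_zero_iff.2 hz)] with w hw
      exact ih (by omega) w (mem_ball_zero_iff.1 hw)
    rw [h.deriv_eq]
    refine ((hf k (by omega)).hasDerivAt ?_ hz).deriv
    have h1 := hf (k + 1) hk
    rwa [Function.iterate_succ_apply'] at h1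

end DiskSummable

/-- By compactness `p` is analytic on a disk of radius `1 + δ`; bounding its Taylor coefficients at
radius `1 + δ / 2` gives geometric decay. -/
theorem exists_overConvergent {p : ℂ → ℂ} (hp : AnalyticOnNhd ℂ p (Metric.closedBall 0 1)) :
    ∃ c : ℂ⟦X⟧, OverConvergent c ∧ ∀ z : ℂ, ‖z‖ < 1 → seriesFun c z = p z := by
  obtain ⟨δ, hδ, hsub⟩ := (isCompact_closedBall (0 : ℂ) 1).exists_cthickening_subset_open
    (isOpen_analyticAt ℂ p) hp
  rw [cthickening_closedBall hδ.le zero_le_one] at hsub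
  lift δ to NNReal using hδ.le
  have hδ' : (0 : ℝ) < δ := hδ
  have hs : HasFPowerSeriesOnBall p (cauchyPowerSeries p 0 (δ + 1 : NNReal)) 0 (δ + 1 : NNReal) :=
    DifferentiableOn.hasFPowerSeriesOnBall
      (fun z hz => (hsub (by simpa using hz)).differentiableAt.differentiableWithinAt)
      (by positivity)
  set q := cauchyPowerSeries p 0 (δ + 1 : NNReal) with hq
  have h1 : ((1 + δ / 2 : NNReal) : ℝ≥0∞) < q.radius := by
    refine lt_of_lt_of_le ?_ hs.r_le
    rw [ENNReal.coe_lt_coe, ← NNReal.coe_lt_coe]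
    push_cast
    linarith
  obtain ⟨C, -, hC⟩ := q.norm_mul_pow_le_of_lt_radius h1
  have hR : (1 : ℝ) < ((1 + δ / 2 : NNReal) : ℝ) := by push_cast; linarith
  have hR0 : (0 : ℝ) < ((1 + δ / 2 : NNReal) : ℝ) := by linarith
  refine ⟨PowerSeries.mk q.coeff, ⟨_, C, inv_pos.2 hR0, inv_lt_one_of_one_lt₀ hR, fun n => ?_⟩,
    fun z hz => ?_⟩
  · rw [PowerSeries.coeff_mk, inv_pow, ← div_eq_mul_inv, le_div_iff₀ (by positivity)]
    simpa only [FormalMultilinearSeries.norm_apply_eq_norm_coef] using hC n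
  · have h2 := hs.hasSum (y := z) (by
      rw [Metric.eball_coe, mem_ball_zero_iff]
      push_cast
      linarith)
    rw [zero_add] at h2
    refine Eq.trans (tsum_congr fun n => ?_) h2.tsum_eq
    rw [PowerSeries.coeff_mk, FormalMultilinearSeries.apply_eq_pow_smul_coeff, smul_eq_mul,
      mul_comm]

/-! ### Convergence in the disk and multiplication operators on `H_β` -/

namespace weightedHardy

variable {β : ℕ → ℝ} [hβ : Fact (∀ n, 0 < β n)] [RegularWeight β]

theorem diskSummable {f : ℂ⟦X⟧} (hf : f ∈ weightedHardy β) : DiskSummable f := by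
  intro r hr0 hr
  obtain ⟨ρ, hρ, hρr⟩ : ∃ ρ : ℝ, 1 < ρ ∧ r * ρ < 1 := by
    obtain ⟨s, hs, hs1⟩ := exists_between hr
    have hs0 := hr0.trans_lt hs
    exact ⟨s⁻¹, (one_lt_inv₀ hs0).2 hs1, by rwa [← div_eq_mul_inv, div_lt_one hs0]⟩
  obtain ⟨C, hC, h⟩ := exists_backward_bound (β := β) hρ
  have hρ0 := one_pos.trans hρ
  refine Summable.of_nonneg_of_le (fun n => by positivity) (fun n => ?_)
    ((summable_geometric_of_lt_one (by positivity) hρr).mul_left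
      (‖(⟨f, hf⟩ : weightedHardy β)‖ * (C / β 0)))
  have h0 := hβ.out 0
  have hn := hβ.out n
  have h1 : (β n)⁻¹ ≤ C * ρ ^ n / β 0 := by
    have := h 0 n
    rw [zero_add] at this
    rw [le_div_iff₀ h0, inv_mul_le_iff₀ hn]
    linarith
  calc ‖PowerSeries.coeff n f‖ * r ^ n
      ≤ ‖(⟨f, hf⟩ : weightedHardy β)‖ / β n * r ^ n := by
        gcongr; exact norm_coeff_le (⟨f, hf⟩ : weightedHardy β) n
    _ ≤ ‖(⟨f, hf⟩ : weightedHardy β)‖ * (C * ρ ^ n / β 0) * r ^ n := by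
        rw [div_eq_mul_inv]; gcongr
    _ = _ := by rw [mul_pow]; ring

/-- Multiplication by an analytic function on a neighborhood of the closed disk is bounded. -/
theorem exists_mulOp {c : ℂ⟦X⟧} (hc : OverConvergent c) :
    ∃ M : weightedHardy β →L[ℂ] weightedHardy β, ∀ f, (M f : ℂ⟦X⟧) = c * (f : ℂ⟦X⟧) := by
  obtain ⟨r, C, hr0, hr, hc⟩ := hc
  obtain ⟨ρ, hρ, hρr⟩ : ∃ ρ : ℝ, 1 < ρ ∧ r * ρ < 1 := by
    obtain ⟨s, hs, hs1⟩ := exists_between hr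
    have hs0 := hr0.trans hs
    exact ⟨s⁻¹, (one_lt_inv₀ hs0).2 hs1, by rwa [← div_eq_mul_inv, div_lt_one hs0]⟩
  obtain ⟨C', hC', h⟩ := exists_shift_pow (β := β) hρ
  choose A hA hA' using h
  have hρ0 := one_pos.trans hρ
  -- The operator is `∑ cₖ zᵏ`, convergent in operator norm because the decay `rᵏ` of `cₖ` beats the
  -- growth `ρᵏ` of the shifts.
  have hsum : Summable fun k => PowerSeries.coeff k c • A k := by
    refine Summable.of_norm_bounded
      ((summable_geometric_of_lt_one (by positivity) hρr).mul_left (C * C')) fun k => ?_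
    rw [norm_smul]
    calc _ ≤ C * r ^ k * (C' * ρ ^ k) :=
          mul_le_mul (hc k) (hA' k) (norm_nonneg _) ((norm_nonneg _).trans (hc k))
      _ = _ := by rw [mul_pow]; ring
  refine ⟨∑' k, PowerSeries.coeff k c • A k, fun f => PowerSeries.ext fun n => ?_⟩
  have h1 : HasSum (fun k => PowerSeries.coeff k c * coeffL β n (A k f))
      (coeffL β n ((∑' k, PowerSeries.coeff k c • A k) f)) := by
    have := ((coeffL β n) ∘L (ContinuousLinearMap.apply ℂ _ f)).hasSum hsum.hasSum
    simpa using this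
  rw [← coeffL_apply, ← h1.tsum_eq, tsum_eq_sum (s := Finset.range (n + 1)), PowerSeries.coeff_mul,
    Finset.Nat.sum_antidiagonal_eq_sum_range_succ fun i j =>
      PowerSeries.coeff i c * PowerSeries.coeff j (f : ℂ⟦X⟧)]
  · refine Finset.sum_congr rfl fun k hk => ?_
    rw [hA, if_neg (by have := Finset.mem_range.1 hk; omega), coeffL_apply]
  · intro k hk
    rw [hA, if_pos (by simpa using hk), mul_zero]

end weightedHardy

/-! ### Zeros in the disk -/

/-- The value at `1` rules out `p ≡ 0`, so zeros are isolated and the compact closed disk holds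
finitely many. Finiteness is what allows the `finsum` in `diskZeroCount` to be split. -/
theorem support_analyticOrderNatAt_finite {p : ℂ → ℂ}
    (hp : AnalyticOnNhd ℂ p (Metric.closedBall 0 1)) (h1 : p 1 ≠ 0) :
    (Metric.ball (0 : ℂ) 1 ∩ Function.support (analyticOrderNatAt p)).Finite := by
  have h := hp.preimage_zero_mem_codiscreteWithin h1 (by simp)
    ((convex_closedBall (0 : ℂ) 1).isConnected ⟨0, by simp⟩)
  refine ((isCompact_closedBall (0 : ℂ) 1).finite_sdiff_of_mem_codiscreteWithin h).subset ?_
  rintro z ⟨hz, hz'⟩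
  refine ⟨Metric.ball_subset_closedBall hz, fun hne => hne ?_⟩
  exact apply_eq_zero_of_analyticOrderNatAt_ne_zero hz'

theorem analyticOrderAt_ne_top_of_mem_closedBall {p : ℂ → ℂ}
    (hp : AnalyticOnNhd ℂ p (Metric.closedBall 0 1)) (h1 : p 1 ≠ 0) {z : ℂ}
    (hz : z ∈ Metric.closedBall (0 : ℂ) 1) : analyticOrderAt p z ≠ ⊤ := by
  have hmem : (1 : ℂ) ∈ Metric.closedBall (0 : ℂ) 1 := by simp
  refine hp.analyticOrderAt_ne_top_of_isPreconnected
    (convex_closedBall (0 : ℂ) 1).isPreconnected hmem hz ?_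
  rw [analyticOrderAt_eq_zero.2 (Or.inr h1)]
  exact ENat.zero_ne_top

theorem diskZeroCount_eq_zero {p : ℂ → ℂ} (h : ∀ z ∈ Metric.ball (0 : ℂ) 1, p z ≠ 0) :
    diskZeroCount p = 0 := by
  refine finsum_mem_eq_zero_of_forall_eq_zero fun z hz => ?_
  by_contra hne
  exact h z hz (apply_eq_zero_of_analyticOrderNatAt_ne_zero hne)

theorem diskZeroCount_sub_mul {p : ℂ → ℂ} (hp : AnalyticOnNhd ℂ p (Metric.closedBall 0 1))
    (h1 : p 1 ≠ 0) {a : ℂ} (ha : a ∈ Metric.ball (0 : ℂ) 1) :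
    diskZeroCount (fun z => (z - a) * p z) = diskZeroCount p + 1 := by
  have hlin : ∀ z, AnalyticAt ℂ (· - a) z := fun z => by fun_prop
  have hne : (1 : ℂ) - a ≠ 0 := by
    intro h
    rw [← sub_eq_zero.1 h] at ha
    simp at ha
  have hord : ∀ z, analyticOrderNatAt (· - a) z = if z = a then 1 else 0 := by
    intro z
    split_ifs with h
    · rw [h, analyticOrderNatAt, analyticOrderAt_id_sub_const_self]; rfl
    · rw [analyticOrderNatAt, analyticOrderAt_id_sub_const_of_ne h]; rfl
  have h2 : ∀ z ∈ Metric.ball (0 : ℂ) 1, analyticOrderNatAt (fun z => (z - a) * p z) z =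
      analyticOrderNatAt (· - a) z + analyticOrderNatAt p z := fun z hz =>
    have hz := Metric.ball_subset_closedBall hz
    analyticOrderNatAt_mul (hlin z) (hp z hz)
      (analyticOrderAt_ne_top_of_mem_closedBall (fun z _ => hlin z) hne hz)
      (analyticOrderAt_ne_top_of_mem_closedBall hp h1 hz)
  rw [diskZeroCount, finsum_mem_congr rfl h2, finsum_mem_add_distrib'
    (support_analyticOrderNatAt_finite (fun z _ => hlin z) hne)
    (support_analyticOrderNatAt_finite hp h1), add_comm]
  congr 1
  refine (finsum_eq_single _ a fun z hz => ?_).trans ?_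
  · simp [hord, hz]
  · simp [hord, mem_ball_zero_iff.1 ha]

theorem AnalyticOnNhd.dslope_closedBall {p : ℂ → ℂ}
    (hp : AnalyticOnNhd ℂ p (Metric.closedBall 0 1)) {a : ℂ} (ha : a ∈ Metric.ball (0 : ℂ) 1) :
    AnalyticOnNhd ℂ (dslope p a) (Metric.closedBall 0 1) := by
  have hopen : IsOpen {z | AnalyticAt ℂ p z} := isOpen_analyticAt ℂ p
  have hd : DifferentiableOn ℂ (dslope p a) {z | AnalyticAt ℂ p z} :=
    (Complex.differentiableOn_dslope
      (hopen.mem_nhds (hp a (Metric.ball_subset_closedBall ha)))).2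
        fun z hz => AnalyticAt.differentiableWithinAt hz
  exact fun z hz => hd.analyticAt (hopen.mem_nhds (hp z hz))

/-! ### Left inverses of multiplication operators -/

theorem finrank_ker_comp_of_surjective {V W U : Type*} [AddCommGroup V] [Module ℂ V]
    [AddCommGroup W] [Module ℂ W] [AddCommGroup U] [Module ℂ U] (f : V →ₗ[ℂ] W) (g : W →ₗ[ℂ] U)
    (hf : Function.Surjective f) [FiniteDimensional ℂ (LinearMap.ker f)]
    [FiniteDimensional ℂ (LinearMap.ker g)] :
    FiniteDimensional ℂ (LinearMap.ker (g ∘ₗ f)) ∧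
      Module.finrank ℂ (LinearMap.ker (g ∘ₗ f)) =
        Module.finrank ℂ (LinearMap.ker f) + Module.finrank ℂ (LinearMap.ker g) := by
  obtain ⟨s, hs⟩ := f.exists_rightInverse_of_surjective (LinearMap.range_eq_top.2 hf)
  replace hs : ∀ w, f (s w) = w := LinearMap.congr_fun hs
  let e : (LinearMap.ker f × LinearMap.ker g) →ₗ[ℂ] LinearMap.ker (g ∘ₗ f) :=
    (((LinearMap.ker f).subtype).coprod (s ∘ₗ (LinearMap.ker g).subtype)).codRestrict _ fun x => by
      have h1 : f x.1 = 0 := x.1.2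
      have h2 : g x.2 = 0 := x.2.2
      simp [hs, h1, h2]
  have he : ∀ x, (e x : V) = x.1 + s x.2 := fun _ => rfl
  have hfe : ∀ x, f (e x) = x.2 := fun x => by
    rw [he, map_add, hs, LinearMap.mem_ker.1 x.1.2, zero_add]
  have hbij : Function.Bijective e := by
    constructor
    · refine (injective_iff_map_eq_zero e).2 fun x hx => ?_
      have h2 : (x.2 : W) = 0 := by rw [← hfe, hx]; simp
      have h1 : (x.1 : V) = 0 := by
        have := he x
        rw [hx, h2, map_zero, add_zero] at this
        exact this.symm
      exact Prod.ext (Subtype.ext h1) (Subtype.ext h2)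
    · rintro ⟨x, hx⟩
      refine ⟨(⟨x - s (f x), ?_⟩, ⟨f x, hx⟩), Subtype.ext ?_⟩
      · rw [LinearMap.mem_ker, map_sub, hs, sub_self]
      · rw [he]; exact sub_add_cancel _ _
  have E := LinearEquiv.ofBijective e hbij
  exact ⟨E.finiteDimensional, by rw [← E.finrank_eq, Module.finrank_prod]⟩

/-- The element `1 - xᵏ` is a unit by the Neumann series, and `1 - x` is one of two commuting
factors of it. -/
theorem isUnit_one_sub_of_norm_pow_lt_one {A : Type*} [NormedRing A] [CompleteSpace A] {x : A}
    {k : ℕ} (h : ‖x ^ k‖ < 1) : IsUnit (1 - x) := by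
  have hc : Commute (1 - x) (∑ i ∈ Finset.range k, x ^ i) :=
    Commute.sum_right _ _ _ fun i _ => (Commute.one_left _).sub_left ((Commute.refl x).pow_right i)
  have hu : IsUnit ((1 - x) * ∑ i ∈ Finset.range k, x ^ i) := by
    rw [mul_neg_geom_sum]
    exact ⟨Units.oneSub _ h, rfl⟩
  exact (hc.isUnit_mul_iff.1 hu).1

/-- `E` is a left inverse of `M` whose null space has dimension `K`. -/
structure IsLeftInverseOfDim {H : Type*} [NormedAddCommGroup H] [NormedSpace ℂ H]
    (E M : H →L[ℂ] H) (K : ℕ) : Prop where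
  mul_eq_one : E * M = 1
  finite_ker : FiniteDimensional ℂ (LinearMap.ker E.toLinearMap)
  finrank_ker : Module.finrank ℂ (LinearMap.ker E.toLinearMap) = K

namespace IsLeftInverseOfDim

variable {H : Type*} [NormedAddCommGroup H] [NormedSpace ℂ H]

theorem surjective {E M : H →L[ℂ] H} {K : ℕ} (h : IsLeftInverseOfDim E M K) :
    Function.Surjective E := fun x => ⟨M x, congrArg (fun A : H →L[ℂ] H => A x) h.mul_eq_one⟩

theorem mul {E₁ M₁ E₂ M₂ : H →L[ℂ] H} {K₁ K₂ : ℕ} (h₁ : IsLeftInverseOfDim E₁ M₁ K₁)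
    (h₂ : IsLeftInverseOfDim E₂ M₂ K₂) : IsLeftInverseOfDim (E₂ * E₁) (M₁ * M₂) (K₁ + K₂) := by
  have := h₁.finite_ker
  have := h₂.finite_ker
  obtain ⟨hfin, hrank⟩ :=
    finrank_ker_comp_of_surjective E₁.toLinearMap E₂.toLinearMap h₁.surjective
  refine ⟨?_, hfin, by rw [← h₁.finrank_ker, ← h₂.finrank_ker]; exact hrank⟩
  rw [mul_assoc, ← mul_assoc E₁, h₁.mul_eq_one, one_mul, h₂.mul_eq_one]

/-- A left inverse up to a unit can be corrected by that unit on the left, which leaves the null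
space unchanged. -/
theorem units_mul {E M : H →L[ℂ] H} {K : ℕ} (u : (H →L[ℂ] H)ˣ)
    (hE : E * M = u) (hfin : FiniteDimensional ℂ (LinearMap.ker E.toLinearMap))
    (hrank : Module.finrank ℂ (LinearMap.ker E.toLinearMap) = K) :
    IsLeftInverseOfDim (u⁻¹.val * E) M K := by
  have hker : LinearMap.ker (u⁻¹.val * E).toLinearMap = LinearMap.ker E.toLinearMap := by
    ext x
    constructor
    · intro hx
      have h1 : (u.val * (u⁻¹.val * E)) x = 0 := by
        rw [mul_apply_eq_comp]
        exact (congrArg _ hx).trans (map_zero _)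
      rwa [Units.mul_inv_cancel_left] at h1
    · intro hx
      exact (congrArg u⁻¹.val hx).trans (map_zero _)
  refine ⟨by rw [mul_assoc, hE, Units.inv_mul], ?_, ?_⟩
  · rw [hker]; exact hfin
  · rw [hker]; exact hrank

theorem of_mul_eq_one {E M : H →L[ℂ] H} (h : E * M = 1) (h' : M * E = 1) :
    IsLeftInverseOfDim E M 0 := by
  have hker : LinearMap.ker E.toLinearMap = ⊥ := by
    refine LinearMap.ker_eq_bot'.2 fun x hx => ?_
    have h1 : (M * E) x = 0 := (congrArg M hx).trans (map_zero M)
    rwa [h'] at h1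
  refine ⟨h, ?_, ?_⟩
  · rw [hker]; infer_instance
  · rw [hker]; exact finrank_bot ℂ H

end IsLeftInverseOfDim

theorem overConvergent_X_sub_C {a : ℂ} (ha : ‖a‖ < 1) :
    OverConvergent (PowerSeries.X - PowerSeries.C a) := by
  refine ⟨1 / 2, 2, by norm_num, by norm_num, fun n => ?_⟩
  rw [map_sub, PowerSeries.coeff_X, PowerSeries.coeff_C]
  rcases n with _ | _ | n
  · simp; linarith
  · simp
  · simp

theorem seriesFun_X_sub_C (a z : ℂ) :
    seriesFun (PowerSeries.X - PowerSeries.C a) z = z - a := by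
  rw [seriesFun, tsum_eq_sum (s := Finset.range 2)]
  · simp [Finset.sum_range_succ, PowerSeries.coeff_X, PowerSeries.coeff_C]
    ring
  · intro n hn
    have hn' : 2 ≤ n := by simpa [Nat.succ_le_iff] using hn
    rw [map_sub, PowerSeries.coeff_X, PowerSeries.coeff_C, if_neg (by omega), if_neg (by omega)]
    simp

/-! ### Left inverses with nullity equal to the number of zeros -/

namespace weightedHardy

variable {β : ℕ → ℝ} [hβ : Fact (∀ n, 0 < β n)] [RegularWeight β]

/-- With `B` the backward shift, `B (z - a) = 1 - a B`, so `(1 - a B)⁻¹ B` is a left inverse, and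
its null space is that of `B`, the constants. The norm of `a B` itself may exceed `1`, but `‖(a B)ᵏ‖
≤ C (|a| ρ)ᵏ` tends to `0`. -/
theorem exists_isLeftInverseOfDim_X_sub_C {a : ℂ} (ha : ‖a‖ < 1)
    {M : weightedHardy β →L[ℂ] weightedHardy β}
    (hM : ∀ f, (M f : ℂ⟦X⟧) = (PowerSeries.X - PowerSeries.C a) * (f : ℂ⟦X⟧)) :
    ∃ E, IsLeftInverseOfDim E M 1 := by
  obtain ⟨ρ, hρ, hρa⟩ : ∃ ρ : ℝ, 1 < ρ ∧ ‖a‖ * ρ < 1 := by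
    obtain ⟨s, hs, hs1⟩ := exists_between ha
    have hs0 := (norm_nonneg a).trans_lt hs
    exact ⟨s⁻¹, (one_lt_inv₀ hs0).2 hs1, by rwa [← div_eq_mul_inv, div_lt_one hs0]⟩
  have hρ0 := one_pos.trans hρ
  obtain ⟨C, hC, h⟩ := exists_backward_pow (β := β) hρ
  choose A hA hA' using h
  have hpow : ∀ k, A 1 ^ k = A k := by
    intro k
    induction k with
    | zero =>
      ext1 f
      exact ext_coeff fun n => by rw [hA, pow_zero]; rfl
    | succ k ih =>
      ext1 f
      refine ext_coeff fun n => ?_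
      rw [pow_succ', ih, mul_apply_eq_comp, hA, hA, hA]
      congr 2
      ring
  have hunit : IsUnit (1 - a • A 1) := by
    have hlim : Tendsto (fun k => C * (‖a‖ * ρ) ^ k) atTop (𝓝 (C * 0)) :=
      (tendsto_pow_atTop_nhds_zero_of_lt_one (by positivity) hρa).const_mul C
    rw [mul_zero] at hlim
    obtain ⟨k, hk⟩ := (hlim.eventually (gt_mem_nhds one_pos)).exists
    refine isUnit_one_sub_of_norm_pow_lt_one (k := k) (lt_of_le_of_lt ?_ hk)
    rw [smul_pow, hpow, norm_smul, norm_pow, mul_pow]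
    calc _ ≤ ‖a‖ ^ k * (C * ρ ^ k) := by gcongr; exact hA' k
      _ = _ := by ring
  obtain ⟨u, hu⟩ := hunit
  have hker : ∀ x : LinearMap.ker (A 1).toLinearMap, ∀ n, coeffL β (n + 1) x = 0 := fun x n => by
    rw [← hA]
    exact congrArg (coeffL β n) x.2
  let e : LinearMap.ker (A 1).toLinearMap →ₗ[ℂ] ℂ :=
    (coeffL β 0).toLinearMap ∘ₗ (LinearMap.ker (A 1).toLinearMap).subtype
  have he : Function.Bijective e := by
    constructor
    · refine (injective_iff_map_eq_zero e).2 fun x hx => Subtype.ext (ext_coeff fun n => ?_)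
      cases n with
      | zero => exact hx
      | succ n => exact hker x n
    · intro c
      have hc : PowerSeries.C c ∈ weightedHardy β := mem_of_finite (m := 1) fun n hn => by
        rw [PowerSeries.coeff_C, if_neg (by omega)]
      refine ⟨⟨⟨PowerSeries.C c, hc⟩, ext_coeff fun n => ?_⟩, ?_⟩
      · refine (hA 1 _ n).trans ?_
        rw [coeffL_apply, PowerSeries.coeff_C, if_neg (by omega), map_zero]
      · change PowerSeries.coeff 0 (PowerSeries.C c) = c
        simp
  have e' := LinearEquiv.ofBijective e he
  refine ⟨_, IsLeftInverseOfDim.units_mul u ?_ e'.symm.finiteDimensional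
    (by rw [e'.finrank_eq, Module.finrank_self])⟩
  rw [hu]
  ext1 f
  refine ext_coeff fun n => ?_
  rw [mul_apply_eq_comp, hA, coeffL_apply, hM, sub_mul, map_sub,
    PowerSeries.coeff_succ_X_mul, PowerSeries.coeff_C_mul]
  simp only [sub_apply, smul_apply, map_sub, map_smul, hA,
    coeffL_apply, smul_eq_mul]
  rfl

/-- Induction on the number of zeros: a zero `a` is split off by `p = (z - a) * dslope p a`, and
nullities of left inverses add under composition. When no zero remains, multiplication by `1 / p` is
a two-sided inverse. -/
theorem exists_isLeftInverseOfDim_diskZeroCount (K : ℕ) : ∀ {p : ℂ → ℂ} {c : ℂ⟦X⟧}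
    {M : weightedHardy β →L[ℂ] weightedHardy β},
    AnalyticOnNhd ℂ p (Metric.closedBall 0 1) → (∀ z : ℂ, ‖z‖ = 1 → p z ≠ 0) →
    diskZeroCount p = K → OverConvergent c → (∀ z : ℂ, ‖z‖ < 1 → seriesFun c z = p z) →
    (∀ f, (M f : ℂ⟦X⟧) = c * (f : ℂ⟦X⟧)) → ∃ E, IsLeftInverseOfDim E M K := by
  induction K with
  | zero =>
    intro p c M hp hne hK hc hcp hM
    -- A zero could be split off and would force a count of at least one.
    have hball : ∀ z ∈ Metric.ball (0 : ℂ) 1, p z ≠ 0 := by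
      intro a ha h0
      have hd := hp.dslope_closedBall ha
      have hfac : p = fun z => (z - a) * dslope p a z := by
        funext z
        have := sub_smul_dslope p a z
        rw [h0, sub_zero] at this
        exact this.symm
      have h1 : dslope p a 1 ≠ 0 := fun h => by
        have := congrFun hfac 1
        rw [h, mul_zero] at this
        exact hne 1 (by simp) this
      rw [hfac, diskZeroCount_sub_mul hd h1 ha] at hK
      omega
    have hinv : AnalyticOnNhd ℂ (fun z => (p z)⁻¹) (Metric.closedBall 0 1) := fun z hz =>
      (hp z hz).inv (by
        rcases (mem_closedBall_zero_iff.1 hz).lt_or_eq with h | h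
        · exact hball z (mem_ball_zero_iff.2 h)
        · exact hne z h)
    obtain ⟨d, hd, hdp⟩ := exists_overConvergent hinv
    obtain ⟨E, hE⟩ := exists_mulOp (β := β) hd
    have hone : OverConvergent 1 := by
      refine ⟨1 / 2, 1, by norm_num, by norm_num, fun n => ?_⟩
      rw [PowerSeries.coeff_one]
      split_ifs with h
      · simp [h]
      · simp
    have hdc : d * c = 1 := by
      refine (hd.diskSummable.mul hc.diskSummable).eq_of_seriesFun_eq hone.diskSummable
        fun z hz => ?_
      rw [hd.diskSummable.seriesFun_mul hc.diskSummable hz, hcp z hz, hdp z hz,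
        inv_mul_cancel₀ (hball z (mem_ball_zero_iff.2 hz)), seriesFun, tsum_eq_single 0]
      · simp
      · intro n hn
        rw [PowerSeries.coeff_one, if_neg hn, zero_mul]
    refine ⟨E, IsLeftInverseOfDim.of_mul_eq_one ?_ ?_⟩
    · ext1 f
      refine Subtype.ext ?_
      rw [mul_apply_eq_comp, hE, hM, ← mul_assoc, hdc, one_mul]
      rfl
    · ext1 f
      refine Subtype.ext ?_
      rw [mul_apply_eq_comp, hM, hE, ← mul_assoc, mul_comm c, hdc, one_mul]
      rfl
  | succ K ih =>
    intro p c M hp hne hK hc hcp hM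
    obtain ⟨a, ha, h0⟩ : ∃ a ∈ Metric.ball (0 : ℂ) 1, p a = 0 := by
      by_contra! h
      rw [diskZeroCount_eq_zero h] at hK
      omega
    have hd := hp.dslope_closedBall ha
    have hfac : ∀ z, p z = (z - a) * dslope p a z := fun z => by
      have := sub_smul_dslope p a z
      rw [h0, sub_zero] at this
      exact this.symm
    have hne' : ∀ z : ℂ, ‖z‖ = 1 → dslope p a z ≠ 0 := fun z hz h => by
      refine hne z hz ?_
      rw [hfac, h, mul_zero]
    have hcount : diskZeroCount (dslope p a) = K := by
      have := diskZeroCount_sub_mul hd (hne' 1 (by simp)) ha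
      rw [← show p = fun z => (z - a) * dslope p a z from funext hfac, hK] at this
      omega
    have ha' := mem_ball_zero_iff.1 ha
    obtain ⟨d, hd', hdp⟩ := exists_overConvergent hd
    obtain ⟨M₂, hM₂⟩ := exists_mulOp (β := β) hd'
    have hX := overConvergent_X_sub_C ha'
    obtain ⟨M₁, hM₁⟩ := exists_mulOp (β := β) hX
    obtain ⟨E₂, hE₂⟩ := ih hd hne' hcount hd' hdp hM₂
    obtain ⟨E₁, hE₁⟩ := exists_isLeftInverseOfDim_X_sub_C ha' hM₁
    have hcd : c = (PowerSeries.X - PowerSeries.C a) * d := by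
      refine hc.diskSummable.eq_of_seriesFun_eq (hX.diskSummable.mul hd'.diskSummable)
        fun z hz => ?_
      rw [hX.diskSummable.seriesFun_mul hd'.diskSummable hz, seriesFun_X_sub_C, hcp z hz,
        hdp z hz, hfac]
    have hMM : M = M₁ * M₂ := by
      ext1 f
      refine Subtype.ext ?_
      rw [mul_apply_eq_comp, hM, hM₁, hM₂, hcd, mul_assoc]
    rw [hMM, add_comm]
    exact ⟨_, hE₁.mul hE₂⟩

end weightedHardy

/-! ### The operator `L` on `H_β` -/

instance regularWeight_weight (σ : ℝ) [hσ : Fact (0 < σ)] : RegularWeight (weight σ) where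
  tendsto_ratio := by
    have h1 : Tendsto (fun n : ℕ => (1 + (1 - σ) / ((n : ℝ) + σ))) atTop (𝓝 (1 + 0)) :=
      (tendsto_const_nhds.div_atTop
        (tendsto_natCast_atTop_atTop.atTop_add tendsto_const_nhds)).const_add 1
    have h2 := (Real.continuous_sqrt.tendsto _).comp h1
    rw [add_zero, Real.sqrt_one] at h2
    refine h2.congr fun n => ?_
    have hn : (0 : ℝ) < n + σ := add_pos_of_nonneg_of_pos n.cast_nonneg hσ.out
    rw [weight, weight, ← Real.sqrt_div' _ (weightSq_pos hσ.out n).le, weightSq,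
      mul_div_cancel_left₀ _ (weightSq_pos hσ.out n).ne', Function.comp_apply]
    congr 1
    field_simp
    ring

/-! ### Differentiation and integration on `H_β` -/

namespace weightedHardy

variable {β : ℕ → ℝ} [hβ : Fact (∀ n, 0 < β n)]

/-- Here `f = f(0) + S f'`. Consequently membership of `Dᴺ f` controls all lower derivatives, so
every term of `L f` lies in `H_β`. -/
theorem mem_of_derivative_mem [RegularWeight β] {f : ℂ⟦X⟧}
    (h : PowerSeries.derivative ℂ f ∈ weightedHardy β) :
    f ∈ weightedHardy β := by
  obtain ⟨S, hS⟩ := exists_integration (β := β)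
  have hc : PowerSeries.C (PowerSeries.coeff 0 f) ∈ weightedHardy β :=
    mem_of_finite (m := 1) fun n hn => by rw [PowerSeries.coeff_C, if_neg (by omega)]
  have hf : f = PowerSeries.C (PowerSeries.coeff 0 f) + (S ⟨_, h⟩ : weightedHardy β) := by
    ext n
    rw [map_add, ← coeffL_apply n (S _), hS, coeffL_apply, PowerSeries.coeff_derivative,
      PowerSeries.coeff_C]
    cases n with
    | zero => simp
    | succ n =>
      have : (n : ℂ) + 1 ≠ 0 := Nat.cast_add_one_ne_zero n
      simp
      field_simp
  rw [hf]
  exact add_mem hc (S ⟨_, h⟩).2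

theorem iterate_derivative_mem [RegularWeight β] {f : ℂ⟦X⟧} {N : ℕ}
    (h : (PowerSeries.derivative ℂ)^[N] f ∈ weightedHardy β) {k : ℕ} (hk : k ≤ N) :
    (PowerSeries.derivative ℂ)^[k] f ∈ weightedHardy β := by
  induction N, hk using Nat.le_induction with
  | base => exact h
  | succ n _ ih =>
    rw [Function.iterate_succ_apply'] at h
    exact ih (mem_of_derivative_mem h)

section
variable {S : weightedHardy β →L[ℂ] weightedHardy β}
  (hS : ∀ f n, coeffL β n (S f) = (n : ℂ)⁻¹ * coeffL β (n - 1) f)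
include hS

theorem derivative_integration (g : weightedHardy β) :
    PowerSeries.derivative ℂ (S g : ℂ⟦X⟧) = g := by
  ext n
  have : (n : ℂ) + 1 ≠ 0 := Nat.cast_add_one_ne_zero n
  rw [PowerSeries.coeff_derivative, ← coeffL_apply, hS, Nat.add_sub_cancel, coeffL_apply]
  push_cast
  field_simp

theorem iterate_derivative_integration (k j : ℕ) (g : weightedHardy β) :
    (PowerSeries.derivative ℂ)^[k] ((S ^ (k + j)) g : ℂ⟦X⟧) = (S ^ j) g := by
  induction k with
  | zero => simp
  | succ k ih =>
    rw [Function.iterate_succ_apply, show k + 1 + j = (k + j) + 1 by ring, pow_succ',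
      mul_apply_eq_comp, derivative_integration hS, ih]

theorem coeffL_integration_pow_eq_zero {n : ℕ} {g : weightedHardy β}
    (hg : ∀ i < n, coeffL β i g = 0) (N : ℕ) : ∀ i < N + n, coeffL β i ((S ^ N) g) = 0 := by
  induction N with
  | zero => simpa using hg
  | succ N ih =>
    intro i hi
    rw [pow_succ', mul_apply_eq_comp, hS]
    rcases Nat.eq_zero_or_pos i with rfl | hi0
    · simp
    · rw [ih (i - 1) (by omega), mul_zero]

/-- The series `f` and `Sᴺ g` share their `N`-th derivative, which determines every coefficient of
index at least `N`; the others vanish on both sides. -/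
theorem eq_integration_pow {N : ℕ} {f g : weightedHardy β}
    (hfg : (PowerSeries.derivative ℂ)^[N] (f : ℂ⟦X⟧) = g) (hf : ∀ i < N, coeffL β i f = 0) :
    f = (S ^ N) g := by
  refine ext_coeff fun i => ?_
  rcases lt_or_ge i N with hi | hi
  · rw [hf i hi, coeffL_integration_pow_eq_zero hS (n := 0) (by simp) N i (by simpa using hi)]
  · obtain ⟨j, rfl⟩ := Nat.exists_eq_add_of_le' hi
    have h := congrArg (PowerSeries.coeff j)
      (hfg.trans (iterate_derivative_integration hS N 0 g).symm)
    rw [PowerSeries.coeff_iterate_derivative, PowerSeries.coeff_iterate_derivative] at h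
    refine mul_left_cancel₀ ?_ h
    exact_mod_cast (Nat.ascFactorial_pos j N).ne'

end

end weightedHardy

/-! ### Perturbation on tails and prescription of initial coefficients -/

namespace weightedHardy

variable {β : ℕ → ℝ} [hβ : Fact (∀ n, 0 < β n)]

/-- A left invertible operator `M` perturbed by `A S` becomes left invertible, with a left inverse
of the same nullity, when `A S` is composed with a tail projection. -/
theorem exists_isLeftInverseOfDim_add_tail [RegularWeight β]
    {S M E : weightedHardy β →L[ℂ] weightedHardy β}
    (hS : ∀ f n, coeffL β n (S f) = (n : ℂ)⁻¹ * coeffL β (n - 1) f) {K : ℕ}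
    (hE : IsLeftInverseOfDim E M K) (A : weightedHardy β →L[ℂ] weightedHardy β) :
    ∃ (n : ℕ) (P E' : weightedHardy β →L[ℂ] weightedHardy β),
      (∀ f i, coeffL β i (P f) = if i < n then 0 else coeffL β i f) ∧
      IsLeftInverseOfDim E' (M + A * (S * P)) K := by
  have hpos : 0 < ‖E * A‖ + 1 := by positivity
  -- This tolerance gives `‖E A S P‖ < 1`, so `E M' = 1 + E A S P` is a unit.
  obtain ⟨n, P, hP, hSP⟩ := exists_norm_integration_tail_le S hS (inv_pos.2 hpos)
  have hlt : ‖-(E * A * (S * P))‖ < 1 := by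
    rw [norm_neg]
    refine (norm_mul_le _ _).trans_lt ?_
    refine (mul_le_mul_of_nonneg_left hSP (norm_nonneg _)).trans_lt ?_
    rw [← div_eq_mul_inv, div_lt_one hpos]
    exact lt_add_one _
  refine ⟨n, P, _, hP, IsLeftInverseOfDim.units_mul (Units.oneSub _ hlt) ?_ hE.finite_ker
    hE.finrank_ker⟩
  rw [mul_add, hE.mul_eq_one, Units.val_oneSub, sub_neg_eq_add, mul_assoc]

/-- The first `n` coefficients. -/
def initialCoeffs (β : ℕ → ℝ) [Fact (∀ n, 0 < β n)] (n : ℕ) : weightedHardy β →L[ℂ] (Fin n → ℂ) :=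
  ContinuousLinearMap.pi fun i => coeffL β i

theorem initialCoeffs_eq_zero_iff {n : ℕ} {f : weightedHardy β} :
    initialCoeffs β n f = 0 ↔ ∀ i < n, coeffL β i f = 0 :=
  ⟨fun h i hi => congrFun h ⟨i, hi⟩, fun h => funext fun i => h i i.2⟩

theorem exists_initialCoeffs_eq {n : ℕ} (v : Fin n → ℂ) :
    ∃ f : weightedHardy β, initialCoeffs β n f = v ∧
      ∀ i, n ≤ i → PowerSeries.coeff i (f : ℂ⟦X⟧) = 0 := by
  let f : ℂ⟦X⟧ := PowerSeries.mk fun i => if h : i < n then v ⟨i, h⟩ else 0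
  have hf : ∀ i, n ≤ i → PowerSeries.coeff i f = 0 := fun i hi => by
    rw [PowerSeries.coeff_mk, dif_neg (by omega)]
  refine ⟨⟨f, mem_of_finite hf⟩, funext fun i => ?_, hf⟩
  change PowerSeries.coeff i f = v i
  rw [PowerSeries.coeff_mk, dif_pos i.2]

end weightedHardy

open weightedHardy

theorem mem_hardySobolev_iff {σ : ℝ} {N : ℕ} {f : Hardy σ} :
    f ∈ hardySobolev σ N ↔
      (PowerSeries.derivative ℂ)^[N] (f : ℂ⟦X⟧) ∈ weightedHardy (weight σ) := by
  rw [hardySobolev, Submodule.mem_comap, LinearMap.comp_apply, Module.End.pow_apply]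
  rfl

/-! ### Realization of `L` and computation of its index -/

section
variable {σ : ℝ} [Fact (0 < σ)]

theorem exists_differentialOperator {N : ℕ} {c : ℕ → ℂ⟦X⟧} (hc : ∀ k ≤ N, OverConvergent (c k)) :
    ∃ T : Hardy σ →ₗ.[ℂ] Hardy σ, T.domain = hardySobolev σ N ∧
      ∀ f : T.domain, (T f : ℂ⟦X⟧) = ∑ k ∈ Finset.range (N + 1),
        c k * (PowerSeries.derivative ℂ)^[k] ((f : Hardy σ) : ℂ⟦X⟧) := by
  let F : hardySobolev σ N →ₗ[ℂ] ℂ⟦X⟧ := ∑ k ∈ Finset.range (N + 1),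
    LinearMap.mulLeft ℂ (c k) ∘ₗ ((PowerSeries.derivative (R := ℂ)).toLinearMap ^ k) ∘ₗ
      (weightedHardy (weight σ)).subtype ∘ₗ (hardySobolev σ N).subtype
  have hF : ∀ f, F f = ∑ k ∈ Finset.range (N + 1),
      c k * (PowerSeries.derivative ℂ)^[k] ((f : Hardy σ) : ℂ⟦X⟧) := fun f => by
    rw [LinearMap.sum_apply]
    refine Finset.sum_congr rfl fun k _ => ?_
    simp only [LinearMap.comp_apply, LinearMap.mulLeft_apply, Module.End.pow_apply]
    rfl
  have hmem : ∀ f, F f ∈ weightedHardy (weight σ) := fun f => by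
    rw [hF]
    refine sum_mem fun k hk => ?_
    have hk' : k ≤ N := by simpa [Nat.lt_succ_iff] using hk
    obtain ⟨M, hM⟩ := exists_mulOp (β := weight σ) (hc k hk')
    have := (M ⟨_, iterate_derivative_mem (mem_hardySobolev_iff.1 f.2) hk'⟩).2
    rwa [hM] at this
  exact ⟨⟨hardySobolev σ N, F.codRestrict _ hmem⟩, rfl, hF⟩

theorem seriesFun_differentialOperator {N : ℕ} {p : ℕ → ℂ → ℂ} {c : ℕ → ℂ⟦X⟧}
    (hc : ∀ k ≤ N, OverConvergent (c k))
    (hcp : ∀ k ≤ N, ∀ z : ℂ, ‖z‖ < 1 → seriesFun (c k) z = p k z) {f : Hardy σ}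
    (hf : f ∈ hardySobolev σ N) {z : ℂ} (hz : ‖z‖ < 1) :
    seriesFun (∑ k ∈ Finset.range (N + 1),
      c k * (PowerSeries.derivative ℂ)^[k] (f : ℂ⟦X⟧)) z = diffExpr N p (seriesFun f) z := by
  have hD : ∀ k ≤ N, DiskSummable ((PowerSeries.derivative ℂ)^[k] (f : ℂ⟦X⟧)) := fun k hk =>
    weightedHardy.diskSummable (iterate_derivative_mem (mem_hardySobolev_iff.1 hf) hk)
  have hle : ∀ k ∈ Finset.range (N + 1), k ≤ N := fun k hk => by
    simpa [Nat.lt_succ_iff] using hk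
  rw [DiskSummable.seriesFun_sum _ (fun k hk =>
    (hc k (hle k hk)).diskSummable.mul (hD k (hle k hk))) hz, diffExpr]
  refine Finset.sum_congr rfl fun k hk => ?_
  rw [(hc k (hle k hk)).diskSummable.seriesFun_mul (hD k (hle k hk)) hz, hcp k (hle k hk) z hz,
    DiskSummable.iteratedDeriv_eq hD k (hle k hk) z hz]

theorem isFredholmPMap_differentialOperator {N K : ℕ} {c : ℕ → ℂ⟦X⟧}
    (hc : ∀ k ≤ N, OverConvergent (c k)) {M E : Hardy σ →L[ℂ] Hardy σ}
    (hM : ∀ f, (M f : ℂ⟦X⟧) = c N * (f : ℂ⟦X⟧)) (hE : IsLeftInverseOfDim E M K)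
    {T : Hardy σ →ₗ.[ℂ] Hardy σ} (hdom : T.domain = hardySobolev σ N)
    (hT : ∀ f : T.domain, (T f : ℂ⟦X⟧) = ∑ k ∈ Finset.range (N + 1),
        c k * (PowerSeries.derivative ℂ)^[k] ((f : Hardy σ) : ℂ⟦X⟧)) :
    IsFredholmPMap T ∧ fredholmIndex T = (N : ℤ) - (K : ℤ) := by
  obtain ⟨S, hS⟩ := exists_integration (β := weight σ)
  choose! A hA using fun k (hk : k ≤ N) => exists_mulOp (β := weight σ) (hc k hk)
  -- One factor `S` is taken out of each lower-order term `p_k S^(N-k)`, hence the exponent `N - 1 -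
  -- k`.
  obtain ⟨n, P, E', hP, hE'⟩ := exists_isLeftInverseOfDim_add_tail hS hE
    (∑ k ∈ Finset.range N, A k * S ^ (N - 1 - k))
  set M' := M + (∑ k ∈ Finset.range N, A k * S ^ (N - 1 - k)) * (S * P) with hM'
  have hEM : ∀ g, E' (M' g) = g := fun g =>
    congrArg (fun B : Hardy σ →L[ℂ] Hardy σ => B g) hE'.mul_eq_one
  have := hE'.finite_ker
  have hdomain : ∀ f : Hardy σ, f ∈ T.domain ↔
      (PowerSeries.derivative ℂ)^[N] (f : ℂ⟦X⟧) ∈ weightedHardy (weight σ) := fun f => by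
    rw [hdom, mem_hardySobolev_iff]
  have hTM : ∀ (x : T.domain) (g : Hardy σ), (x : Hardy σ) = (S ^ N) g →
      (∀ i < n, coeffL _ i g = 0) → T x = M' g := by
    intro x g hx hg
    have hPg : P g = g := ext_coeff fun i => by
      rw [hP]
      split_ifs with h
      · exact (hg i h).symm
      · rfl
    refine Subtype.ext ?_
    rw [hT, hM', Finset.sum_range_succ, hx, add_apply, mul_apply_eq_comp,
      mul_apply_eq_comp, hPg, Submodule.coe_add, hM, add_comm]
    congr 1
    · rw [show (PowerSeries.derivative ℂ)^[N] ((S ^ N) g : ℂ⟦X⟧) = g by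
        simpa using iterate_derivative_integration hS N 0 g]
    · rw [sum_apply, AddSubmonoidClass.coe_finsetSum]
      refine Finset.sum_congr rfl fun k hk => ?_
      have hk' := Finset.mem_range.1 hk
      have h1 := iterate_derivative_integration hS k (N - k) g
      rw [Nat.add_sub_cancel' hk'.le] at h1
      rw [mul_apply_eq_comp, hA k hk'.le, h1, ← mul_apply_eq_comp (S ^ (N - 1 - k)), ← pow_succ,
        show N - 1 - k + 1 = N - k by omega]
  let φ : T.domain →ₗ[ℂ] (Fin (N + n) → ℂ) :=
    (initialCoeffs (weight σ) (N + n)).toLinearMap ∘ₗ T.domain.subtype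
  -- The first component vanishes exactly on the range of `M'`; the second then says that the
  -- preimage `E' y` has no coefficients below `n`. The target has dimension `K + n`.
  let ψ : Hardy σ →L[ℂ] LinearMap.ker E'.toLinearMap × (Fin n → ℂ) :=
    ((1 - M' * E').codRestrict (LinearMap.ker E'.toLinearMap) fun y => by
      change E' (y - M' (E' y)) = 0
      rw [map_sub, hEM, sub_self]).prod (initialCoeffs (weight σ) n ∘L E')
  have hψ : ∀ y, ψ y = 0 ↔ y = M' (E' y) ∧ ∀ i < n, coeffL _ i (E' y) = 0 := fun y => by
    rw [← initialCoeffs_eq_zero_iff, Prod.ext_iff, Subtype.ext_iff, ← sub_eq_zero (a := y)]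
    rfl
  have hφ : ∀ x, φ x = 0 ↔ ∀ i < N + n, coeffL _ i (x : Hardy σ) = 0 := fun x =>
    initialCoeffs_eq_zero_iff
  have hφsurj : Function.Surjective φ := by
    intro v
    obtain ⟨f, hf, hf0⟩ := exists_initialCoeffs_eq (β := weight σ) v
    refine ⟨⟨f, (hdomain f).2 (mem_of_finite (m := N + n) fun i hi => ?_)⟩, hf⟩
    rw [PowerSeries.coeff_iterate_derivative, hf0 _ (by omega), mul_zero]
  have hψsurj : Function.Surjective ψ := by
    rintro ⟨u, v⟩
    obtain ⟨f, hf, -⟩ := exists_initialCoeffs_eq (β := weight σ) v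
    have hu : E' u = 0 := u.2
    -- Elements of `ker E'` and of the range of `M'` can be prescribed independently, since `E' M' =
    -- 1`.
    have hEu : E' (u + M' f) = f := by rw [map_add, hu, hEM, zero_add]
    refine ⟨u + M' f, Prod.ext (Subtype.ext ?_) ?_⟩
    · change u + M' f - M' (E' (u + M' f)) = u
      rw [hEu, add_sub_cancel_right]
    · change initialCoeffs _ n (E' (u + M' f)) = v
      rw [hEu, hf]
  have hfwd : ∀ x, φ x = 0 → ψ (T x) = 0 ∧ ((S ^ N) ∘L E') (T x) = x := by
    intro x hx
    rw [hφ] at hx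
    -- With `g = Dᴺ x`, the first `N` vanishing coefficients of `x` give `x = Sᴺ g`, and the next
    -- `n` give the vanishing of those of `g`.
    let g : Hardy σ := ⟨_, (hdomain x).1 x.2⟩
    have hxg : (x : Hardy σ) = (S ^ N) g := eq_integration_pow hS rfl fun i hi => hx i (by omega)
    have hg : ∀ i < n, coeffL _ i g = 0 := fun i hi => by
      change PowerSeries.coeff i ((PowerSeries.derivative ℂ)^[N] ((x : Hardy σ) : ℂ⟦X⟧)) = 0
      rw [PowerSeries.coeff_iterate_derivative, ← coeffL_apply (β := weight σ) _ x.1,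
        hx _ (by omega), mul_zero]
    rw [hTM x g hxg hg, hψ, hEM, ContinuousLinearMap.comp_apply, hEM]
    exact ⟨⟨rfl, hg⟩, hxg.symm⟩
  have hsurj : ∀ y, ψ y = 0 → ∃ x, φ x = 0 ∧ T x = y := by
    intro y hy
    obtain ⟨hy1, hy2⟩ := (hψ y).1 hy
    have hmem : (S ^ N) (E' y) ∈ T.domain := (hdomain _).2 (by
      have h := iterate_derivative_integration hS N 0 (E' y)
      rw [add_zero] at h
      rw [h]
      exact (E' y).2)
    exact ⟨⟨_, hmem⟩, (hφ _).2 (coeffL_integration_pow_eq_zero hS hy2 N),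
      (hTM _ _ rfl hy2).trans hy1.symm⟩
  obtain ⟨h1, h2⟩ := isFredholmPMap_of_bijective_ker T φ ψ.toLinearMap ((S ^ N) ∘L E') hφsurj
    hψsurj ψ.isClosed_ker hfwd hsurj
  refine ⟨h1, h2.trans ?_⟩
  rw [Module.finrank_prod, hE'.finrank_ker, Module.finrank_fin_fun, Module.finrank_fin_fun]
  push_cast
  ring

end

theorem mainTheorem3 (σ : ℝ) [Fact (0 < σ)] (N : ℕ) (hN : 1 ≤ N) (p : ℕ → ℂ → ℂ)
    (hL : IsDiskRegular N p)
    (hσ : 1 ≤ σ ∨ ∃ P : Polynomial ℂ, ∀ z ∈ Metric.closedBall (0 : ℂ) 1, p N z = P.eval z)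
    (K : ℕ) (hK : diskZeroCount (p N) = K) :
    ∃ T : Hardy σ →ₗ.[ℂ] Hardy σ,
      T.domain = hardySobolev σ N ∧
      (∀ f : T.domain, ∀ z ∈ Metric.ball (0 : ℂ) 1,
        seriesFun (T f : ℂ⟦X⟧) z = diffExpr N p (seriesFun ((f : Hardy σ) : ℂ⟦X⟧)) z) ∧
      IsFredholmPMap T ∧ fredholmIndex T = (N : ℤ) - (K : ℤ) := by
  choose! c hc hcp using fun k (hk : k ≤ N) => exists_overConvergent (hL.analytic k hk)
  obtain ⟨M, hM⟩ := exists_mulOp (β := weight σ) (hc N le_rfl)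
  obtain ⟨E, hE⟩ := exists_isLeftInverseOfDim_diskZeroCount K (hL.analytic N le_rfl) hL.ne_zero hK
    (hc N le_rfl) (hcp N le_rfl) hM
  obtain ⟨T, hdom, hT⟩ := exists_differentialOperator (σ := σ) hc
  refine ⟨T, hdom, fun f z hz => ?_, isFredholmPMap_differentialOperator hc hM hE hdom hT⟩
  rw [hT]
  exact seriesFun_differentialOperator hc hcp (hdom ▸ f.2) (mem_ball_zero_iff.1 hz)

end
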